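/- A (nontrivial) fractal string is a bounded open set $\Omega\subset\mathbb R$ with infinitely many connected components; these are open intervals $I_j$ ($j\ge 1$), of lengths $\ell_j=|I_j|>0$. For $\varepsilon>0$ let $V(\varepsilon)$ be the Lebesgue measure of $\{x\in\Omega : d(x,\partial\Omega)<\varepsilon\}$, and for $d\ge 0$ put $$\mathcal M^*_d=\limsup_{\varepsilon\to0^+}\frac{V(\varepsilon)}{\varepsilon^{1-d}},\qquad \mathcal M_{*,d}=\liminf_{\varepsilon\to0^+}\frac{V(\varepsilon)}{\varepsilon^{1-d}}.$$ The Minkowski dimension of $\Omega$ is $D_\Omega=\inf\{d\ge0:\mathcal M^*_d<\infty\}$, and $\Omega$ is called Minkowski measurable if, with $d=D_\Omega$, $0<\mathcal M_{*,d}=\mathcal M^*_d<\infty$. The spectral counting function of $\Omega$ is $$N_\nu(x)=\#\{(n,j): n\ge1,\ j\ge1,\ n\,\ell_j^{-1}\le x\},$$ that is, the number of frequencies $n\,\ell_j^{-1}$ not exceeding $x$, counted with multiplicity; the Weyl term is $W(x)=|\Omega|\,x$, where $|\Omega|$ is the Lebesgue measure of $\Omega$. For $D\in(0,1)$, say that $(\mathrm{ISP})_D$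 is true if every fractal string $\Omega$ of Minkowski dimension $D$ such that $$N_\nu(x)=W(x)-\mathcal C\,x^D+o(x^D)\quad\text{as }x\to+\infty$$ for some nonzero real constant $\mathcal C$ is Minkowski measurable. **Theorem 6.2 (spectral reformulation of the Riemann hypothesis).** $(\mathrm{ISP})_D$ is true for every $D\in(0,1)$ with $D\ne\tfrac12$ if and only if the Riemann hypothesis is true. Likewise, $(\mathrm{ISP})_D$ is true for every $D\in(0,\tfrac12)$ if and only if the Riemann hypothesis is true. -/

import Mathlib

namespace FractalString

open MeasureTheory Filter Topology

noncomputable section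

/-- The open intervals `I_j` composing `Ω`: its connected components. -/
def intervals (Ω : Set ℝ) : Set (Set ℝ) :=
  {I | ∃ x ∈ Ω, I = connectedComponentIn Ω x}

/-- A (nontrivial) fractal string: a bounded open subset of the line that consists of
infinitely many disjoint open intervals. -/
structure IsFractalString (Ω : Set ℝ) : Prop where
  isOpen : IsOpen Ω
  isBounded : Bornology.IsBounded Ω
  infinite_intervals : (intervals Ω).Infinite

/-- The inner `ε`-neighborhood of the boundary of `Ω`. -/
def innerTube (Ω : Set ℝ) (ε : ℝ) : Set ℝ :=
  {x ∈ Ω | Metric.infDist x (frontier Ω) < ε}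

/-- The quotient `V(ε) / ε ^ (1 - d)`, where `V(ε)` is the length of the inner tube. -/
def tubeRatio (Ω : Set ℝ) (d ε : ℝ) : ENNReal :=
  volume (innerTube Ω ε) / ENNReal.ofReal (ε ^ (1 - d))

/-- The `d`-dimensional upper Minkowski content. -/
def upperContent (Ω : Set ℝ) (d : ℝ) : ENNReal :=
  limsup (tubeRatio Ω d) (𝓝[>] 0)

/-- The `d`-dimensional lower Minkowski content. -/
def lowerContent (Ω : Set ℝ) (d : ℝ) : ENNReal :=
  liminf (tubeRatio Ω d) (𝓝[>] 0)

/-- The (inner, upper) Minkowski dimension. The infimum is over a nonempty set when `Ω` is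
bounded, since `d = 1` belongs to it. -/
def minkowskiDim (Ω : Set ℝ) : ℝ :=
  sInf {d : ℝ | 0 ≤ d ∧ upperContent Ω d < ⊤}

/-- Minkowski measurability: the lower and upper Minkowski contents, taken in the Minkowski
dimension, are equal, positive and finite. -/
def IsMinkowskiMeasurable (Ω : Set ℝ) : Prop :=
  0 < lowerContent Ω (minkowskiDim Ω) ∧
    lowerContent Ω (minkowskiDim Ω) = upperContent Ω (minkowskiDim Ω) ∧
    upperContent Ω (minkowskiDim Ω) < ⊤

/-- The spectral counting function: the number, with multiplicity, of the frequencies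
`n / |I|` (`n ≥ 1`, `I` an interval of `Ω`) not exceeding `x`. -/
def spectralCount (Ω : Set ℝ) (x : ℝ) : ℕ :=
  {p : Set ℝ × ℕ | p.1 ∈ intervals Ω ∧ 1 ≤ p.2 ∧
    (p.2 : ℝ) * (volume.real p.1)⁻¹ ≤ x}.ncard

/-- The Weyl term `|Ω| x`. -/
def weylTerm (Ω : Set ℝ) (x : ℝ) : ℝ := volume.real Ω * x

/-- `(ISP)_D` has an affirmative answer: every fractal string of Minkowski dimension `D` with
`N_ν(x) = W(x) - C x ^ D + o(x ^ D)` for some real `C ≠ 0` is Minkowski measurable. -/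
def ISP (D : ℝ) : Prop :=
  ∀ Ω : Set ℝ, IsFractalString Ω → minkowskiDim Ω = D →
    (∃ C : ℝ, C ≠ 0 ∧
      (fun x : ℝ => (spectralCount Ω x : ℝ) - (weylTerm Ω x - C * x ^ D))
        =o[atTop] (fun x : ℝ => x ^ D)) →
    IsMinkowskiMeasurable Ω

end

end FractalString

/-! Both sides of (ISP)_D depend only on the lengths ℓ_j. An interval of length ℓ carries ⌊ℓx⌋
frequencies up to x, so W(x) - N_ν(x) = ∑ {ℓ_j x} (`fractSum`), while V(ε) = ∑ min(ℓ_j, 2ε)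
(`tubeSum`) is the integral of t ↦ #{j : ℓ_j ≥ t} over (0, 2ε), that count being `countSum` at 1/t.
The two are linked by ∫ {t} t^(-s-1) dt = -ζ(s)/s for 0 < Re s < 1 (`mellin_fract`).

If ζ has no zero on Re s = D, set x = e^t and divide by e^(Dt). The fractional sum and the counting
function become superpositions of translates of two kernels, with Fourier transforms -ζ(s)/s and 1/s
on that line. Dividing by ζ turns convergence of the first into convergence of smooth averages of
the second; monotonicity of the counting function removes the averaging
(`tendsto_of_tendsto_averages`, `tendsto_of_tendsto_fract`). Integration then gives Minkowski
measurability (`isp_of_riemannZeta_ne_zero`).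

If ζ(s) = 0 with Re s = D, take lengths whose counting function is the integer part of x^D + β Re
x^s. A term x^w in the count contributes -ζ(w) x^w to the fractional sum, so the oscillation is
invisible in the spectrum (`tendsto_fractSum_of_zero`) but survives in the tube volume
(`not_tendsto_tubeSum`).

Hence, for D in (0, 1), (ISP)_D holds exactly when ζ has no zero on Re s = D. The functional
equation reflects zeros in the critical line, so the values D < 1/2 already decide the Riemann
hypothesis. That ζ < 0 on (0, 1) makes the constants nonzero in both directions. -/

open MeasureTheory Filter Topology Set
open scoped FourierTransform ContDiff

/-! ### Zeta in the critical strip as a Mellin transform of the fractional part -/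

/-- The fractional part cut off below `1`. -/
noncomputable def fractTail (t : ℝ) : ℂ := (Ioi (1 : ℝ)).indicator (fun t => ((Int.fract t : ℝ) : ℂ)) t

theorem measurable_fractTail : Measurable fractTail :=
  (Complex.measurable_ofReal.comp measurable_fract).indicator measurableSet_Ioi

theorem norm_fract_le (t : ℝ) : ‖((Int.fract t : ℝ) : ℂ)‖ ≤ 1 := by
  rw [Complex.norm_real, Real.norm_of_nonneg (Int.fract_nonneg t)]
  exact (Int.fract_lt_one t).le

theorem norm_fractTail_le (t : ℝ) : ‖fractTail t‖ ≤ 1 :=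
  (norm_indicator_le_norm_self _ _).trans (norm_fract_le t)

theorem locallyIntegrable_of_measurable_of_bound {f : ℝ → ℂ} (hm : Measurable f) {C : ℝ}
    (hC : ∀ t, ‖f t‖ ≤ C) : LocallyIntegrable f := by
  refine (locallyIntegrable_const C).mono hm.aestronglyMeasurable (ae_of_all _ fun t => ?_)
  exact (hC t).trans (le_abs_self C)

theorem fractTail_isBigO_top : fractTail =O[atTop] (fun t : ℝ => t ^ (-(0 : ℝ))) := by
  refine Asymptotics.IsBigO.of_bound 1 (Eventually.of_forall fun t => ?_)
  simpa using norm_fractTail_le t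

theorem fractTail_isBigO_zero (b : ℝ) : fractTail =O[𝓝[>] 0] (fun t : ℝ => t ^ (-b)) := by
  refine Asymptotics.IsBigO.of_bound 1 ?_
  filter_upwards [Ioo_mem_nhdsGT (show (0 : ℝ) < 1 by norm_num)] with t ht
  have : fractTail t = 0 := indicator_of_notMem (by simpa using ht.2.le) _
  rw [this, norm_zero]
  positivity

theorem mellinConvergent_fractTail {w : ℂ} (hw : w.re < 0) : MellinConvergent fractTail w :=
  mellinConvergent_of_isBigO_rpow (a := 0) (b := w.re - 1)
    ((locallyIntegrable_of_measurable_of_bound measurable_fractTail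
      norm_fractTail_le).locallyIntegrableOn _)
    fractTail_isBigO_top hw (fractTail_isBigO_zero _) (by linarith)

theorem differentiableAt_mellin_fractTail {w : ℂ} (hw : w.re < 0) :
    DifferentiableAt ℂ (mellin fractTail) w :=
  mellin_differentiableAt_of_isBigO_rpow (a := 0) (b := w.re - 1)
    ((locallyIntegrable_of_measurable_of_bound measurable_fractTail
      norm_fractTail_le).locallyIntegrableOn _)
    fractTail_isBigO_top hw (fractTail_isBigO_zero _) (by linarith)

theorem mellin_fractTail (w : ℂ) :
    mellin fractTail w = ∫ t in Ioi (1 : ℝ), (t : ℂ) ^ (w - 1) * ((Int.fract t : ℝ) : ℂ) := by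
  have h : ∀ t : ℝ, (t : ℂ) ^ (w - 1) • fractTail t =
      (Ioi (1 : ℝ)).indicator (fun t : ℝ => (t : ℂ) ^ (w - 1) * ((Int.fract t : ℝ) : ℂ)) t := by
    intro t
    by_cases ht : t ∈ Ioi (1 : ℝ) <;> simp [fractTail, ht]
  rw [mellin]
  simp_rw [h]
  rw [setIntegral_indicator measurableSet_Ioi]
  congr 2
  ext x; simp only [mem_inter_iff, mem_Ioi]; constructor
  · exact fun h => h.2
  · exact fun h => ⟨by linarith, h⟩

theorem integrableOn_cpow_mul_fract {w : ℂ} (hw : w.re < 0) :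
    IntegrableOn (fun t : ℝ => (t : ℂ) ^ (w - 1) * ((Int.fract t : ℝ) : ℂ)) (Ioi 1) := by
  have h := (mellinConvergent_fractTail hw).mono_set (Ioi_subset_Ioi (show (0 : ℝ) ≤ 1 by norm_num))
  refine h.congr_fun (fun t ht => ?_) measurableSet_Ioi
  simp [fractTail, mem_Ioi.1 ht]

/-- Partial summation gives ζ(s) = s ∫ ⌊t⌋ t^(-s-1) dt over t > 1; writing ⌊t⌋ = t - {t} isolates
the pole. -/
theorem riemannZeta_eq_of_one_lt_re {s : ℂ} (hs : 1 < s.re) :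
    riemannZeta s = s / (s - 1) - s * mellin fractTail (-s) := by
  have h1 : riemannZeta s = s * ∫ t in Ioi (1 : ℝ), ((⌊t⌋₊ : ℕ) : ℂ) * (t : ℂ) ^ (-(s + 1)) := by
    rw [← LSeries_one_eq_riemannZeta hs, LSeries_eq_mul_integral' 1 zero_le_one hs]
    · simp
    · simp only [Pi.one_apply, norm_one, Finset.sum_const, Nat.card_Icc, add_tsub_cancel_right,
        nsmul_eq_mul, mul_one, Real.rpow_one]
      exact Asymptotics.isBigO_refl _ _
  have h2 : ∫ t in Ioi (1 : ℝ), (t : ℂ) ^ (-s) = 1 / (s - 1) := by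
    rw [integral_Ioi_cpow_of_lt (by simpa using hs) one_pos]
    have : s - 1 ≠ 0 := fun h => by rw [sub_eq_zero.1 h] at hs; simp at hs
    have h' : -s + 1 ≠ 0 := fun h => this (by linear_combination -h)
    simp; field_simp; ring
  have h3 : ∫ t in Ioi (1 : ℝ), ((⌊t⌋₊ : ℕ) : ℂ) * (t : ℂ) ^ (-(s + 1)) =
      (∫ t in Ioi (1 : ℝ), (t : ℂ) ^ (-s)) - mellin fractTail (-s) := by
    rw [mellin_fractTail, ← integral_sub (integrableOn_Ioi_cpow_of_lt (by simpa using hs) one_pos)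
      (integrableOn_cpow_mul_fract (by simpa using (by linarith : 0 < s.re)))]
    refine setIntegral_congr_fun measurableSet_Ioi fun t ht => ?_
    have ht0 : (0 : ℝ) < t := lt_trans one_pos ht
    have e : (t : ℂ) ^ (-s) = t * (t : ℂ) ^ (-(s + 1)) := by
      rw [show -s = -(s + 1) + 1 by ring, Complex.cpow_add _ _ (by exact_mod_cast ht0.ne'),
        Complex.cpow_one, mul_comm]
    have e2 : ((Int.fract t : ℝ) : ℂ) = t - ((⌊t⌋₊ : ℕ) : ℂ) := by
      rw [Int.fract, ← natCast_floor_eq_intCast_floor ht0.le]; push_cast; rfl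
    rw [e, show -s - 1 = -(s + 1) by ring, e2]
    ring
  rw [h1, h3, h2]; ring

/-- Analytic continuation past the pole at 1 in two convex steps: from Re s > 1 through the open
first quadrant, then from there to the whole strip. -/
theorem riemannZeta_eq_of_mem_strip {s : ℂ} (h0 : 0 < s.re) (h1 : s.re < 1) :
    riemannZeta s = s / (s - 1) - s * mellin fractTail (-s) := by
  have hd : ∀ z : ℂ, 0 < z.re → z ≠ 1 →
      DifferentiableAt ℂ (fun s => s / (s - 1) - s * mellin fractTail (-s)) z := by
    intro z hz hz1
    have : DifferentiableAt ℂ (fun s => mellin fractTail (-s)) z :=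
      DifferentiableAt.comp (g := mellin fractTail) z
        (differentiableAt_mellin_fractTail (by simpa using hz)) differentiableAt_id.neg
    have h' : z - 1 ≠ 0 := sub_ne_zero.2 hz1
    fun_prop (disch := assumption)
  have key : ∀ U : Set ℂ, IsOpen U → Convex ℝ U → (∀ z ∈ U, 0 < z.re ∧ z ≠ 1) → ∀ z₀ ∈ U,
      (∀ᶠ z in 𝓝 z₀, riemannZeta z = z / (z - 1) - z * mellin fractTail (-z)) →
      ∀ z ∈ U, riemannZeta z = z / (z - 1) - z * mellin fractTail (-z) := by
    intro U hU hc hp z₀ hz₀ he z hz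
    have a1 : AnalyticOnNhd ℂ riemannZeta U := DifferentiableOn.analyticOnNhd
      (fun z hz => (differentiableAt_riemannZeta (hp z hz).2).differentiableWithinAt) hU
    have a2 : AnalyticOnNhd ℂ (fun s => s / (s - 1) - s * mellin fractTail (-s)) U :=
      DifferentiableOn.analyticOnNhd
        (fun z hz => (hd z (hp z hz).1 (hp z hz).2).differentiableWithinAt) hU
    exact a1.eqOn_of_preconnected_of_eventuallyEq a2 hc.isPreconnected hz₀ he hz
  have o1 : IsOpen {z : ℂ | 0 < z.re} := isOpen_lt continuous_const Complex.continuous_re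
  have o2 : IsOpen {z : ℂ | 0 < z.im} := isOpen_lt continuous_const Complex.continuous_im
  have o3 : IsOpen {z : ℂ | z.re < 1} := isOpen_lt Complex.continuous_re continuous_const
  have o4 : IsOpen {z : ℂ | 1 < z.re} := isOpen_lt continuous_const Complex.continuous_re
  have c1 : Convex ℝ ({z : ℂ | 0 < z.re} ∩ {z : ℂ | 0 < z.im}) :=
    (convex_halfSpace_re_gt 0).inter (convex_halfSpace_im_gt 0)
  have c2 : Convex ℝ ({z : ℂ | 0 < z.re} ∩ {z : ℂ | z.re < 1}) :=
    (convex_halfSpace_re_gt 0).inter (convex_halfSpace_re_lt 1)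
  have step := key _ (o1.inter o2) c1
    (fun z hz => ⟨hz.1, fun h => by have := hz.2; simp [h] at this⟩)
    (2 + Complex.I) (by simp) (by
      filter_upwards [o4.mem_nhds (show (2 + Complex.I) ∈ {z : ℂ | 1 < z.re} by simp)] with z hz
      exact riemannZeta_eq_of_one_lt_re hz)
  refine key _ (o1.inter o3) c2 (fun z hz => ⟨hz.1, fun h => by have := hz.2; simp [h] at this⟩)
    (1 / 2 + Complex.I) (by simp; norm_num) ?_ s ⟨h0, h1⟩
  filter_upwards [(o1.inter o2).mem_nhds
    (show (1 / 2 + Complex.I) ∈ {z : ℂ | 0 < z.re} ∩ {z : ℂ | 0 < z.im} by simp)] with z hz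
  exact step z hz

theorem norm_cpow_real {x : ℝ} (hx : 0 < x) (s : ℂ) : ‖(x : ℂ) ^ s‖ = x ^ s.re :=
  Complex.norm_cpow_eq_rpow_re_of_pos hx s

/-- The difference between `∫ y^(-s)` and `∑ n^(-s)`, up to `k`. -/
noncomputable def powDefect (s : ℂ) (k : ℕ) : ℂ :=
  (k : ℂ) ^ (1 - s) / (1 - s) - ∑ n ∈ Finset.Icc 1 k, (n : ℂ) ^ (-s)

theorem integral_sub_mul_cpow {s : ℂ} (h0 : s ≠ 0) (h1 : s ≠ 1) {k : ℕ} (hk : 1 ≤ k) :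
    ∫ t in (k : ℝ)..((k + 1 : ℕ) : ℝ), (t : ℂ) ^ (-s - 1) * ((Int.fract t : ℝ) : ℂ) =
      (((k + 1 : ℕ) : ℂ) ^ (1 - s) - (k : ℂ) ^ (1 - s)) / (1 - s) +
        (k : ℂ) / s * (((k + 1 : ℕ) : ℂ) ^ (-s) - (k : ℂ) ^ (-s)) := by
  have hk0 : (0 : ℝ) < k := by exact_mod_cast hk
  have hlt : (k : ℝ) < ((k + 1 : ℕ) : ℝ) := by push_cast; linarith
  have hnot : (0 : ℝ) ∉ uIcc (k : ℝ) ((k + 1 : ℕ) : ℝ) := by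
    rw [uIcc_of_le hlt.le]; intro h; linarith [h.1]
  have e : ∫ t in (k : ℝ)..((k + 1 : ℕ) : ℝ), (t : ℂ) ^ (-s - 1) * ((Int.fract t : ℝ) : ℂ) =
      ∫ t in (k : ℝ)..((k + 1 : ℕ) : ℝ), ((t : ℂ) ^ (-s) - k * (t : ℂ) ^ (-s - 1)) := by
    rw [intervalIntegral.integral_of_le hlt.le, intervalIntegral.integral_of_le hlt.le,
      integral_Ioc_eq_integral_Ioo, integral_Ioc_eq_integral_Ioo]
    refine setIntegral_congr_fun measurableSet_Ioo fun t ht => ?_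
    have ht0 : (0 : ℝ) < t := hk0.trans ht.1
    have hfl : ⌊t⌋ = (k : ℤ) := by
      rw [Int.floor_eq_iff]; push_cast
      exact ⟨ht.1.le, by simpa using ht.2⟩
    have e1 : (t : ℂ) ^ (-s) = t * (t : ℂ) ^ (-s - 1) := by
      rw [show -s = (-s - 1) + 1 by ring, Complex.cpow_add _ _ (by exact_mod_cast ht0.ne'),
        Complex.cpow_one, mul_comm]
      simp
    simp only [Int.fract, hfl, e1]
    push_cast; ring
  have hs1 : 1 - s ≠ 0 := sub_ne_zero.2 (Ne.symm h1)
  rw [e, intervalIntegral.integral_sub, intervalIntegral.integral_const_mul, integral_cpow,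
    integral_cpow]
  · push_cast
    rw [show -s + 1 = 1 - s by ring, show -s - 1 + 1 = -s by ring]
    field_simp
    ring
  · exact Or.inr ⟨fun h => h0 (by linear_combination -h), hnot⟩
  · exact Or.inr ⟨fun h => h1 (by linear_combination -h), hnot⟩
  · exact intervalIntegral.intervalIntegrable_cpow (Or.inr hnot)
  · exact (intervalIntegral.intervalIntegrable_cpow (Or.inr hnot)).const_mul _

/-- The defect at k + 1 equals s/(1-s) + s ∫ {t} t^(-s-1) dt over (1, k+1), by telescoping; letting
k grow recovers the strip formula for -ζ(s). -/
theorem tendsto_powDefect {s : ℂ} (hs0 : 0 < s.re) (hs1 : s.re < 1) :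
    Tendsto (powDefect s) atTop (𝓝 (-riemannZeta s)) := by
  have h0 : s ≠ 0 := fun h => by simp [h] at hs0
  have h1 : s ≠ 1 := fun h => by simp [h] at hs1
  have h1' : 1 - s ≠ 0 := sub_ne_zero.2 (Ne.symm h1)
  have h1'' : s - 1 ≠ 0 := sub_ne_zero.2 h1
  have hint := integrableOn_cpow_mul_fract (w := -s) (by simpa using hs0)
  have hI : ∀ k : ℕ, powDefect s (k + 1) = s / (1 - s) + s *
      ∫ t in (1 : ℝ)..((k + 1 : ℕ) : ℝ), (t : ℂ) ^ (-s - 1) * ((Int.fract t : ℝ) : ℂ) := by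
    intro k
    induction k with
    | zero => simp [powDefect]; field_simp; ring
    | succ k ih =>
      have hii : ∀ a b : ℝ, 1 ≤ a → a ≤ b → IntervalIntegrable
          (fun t : ℝ => (t : ℂ) ^ (-s - 1) * ((Int.fract t : ℝ) : ℂ)) volume a b := by
        intro a b ha hab
        rw [intervalIntegrable_iff_integrableOn_Ioc_of_le hab]
        exact hint.mono_set fun x hx => lt_of_le_of_lt ha hx.1
      rw [← intervalIntegral.integral_add_adjacent_intervals
        (hii 1 ((k + 1 : ℕ) : ℝ) le_rfl (by push_cast; linarith [(Nat.cast_nonneg k : (0 : ℝ) ≤ k)]))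
        (hii _ ((k + 1 + 1 : ℕ) : ℝ)
          (by push_cast; linarith [(Nat.cast_nonneg k : (0 : ℝ) ≤ k)]) (by push_cast; linarith)),
        mul_add, ← add_assoc, ← ih, integral_sub_mul_cpow h0 h1 (Nat.le_add_left 1 k)]
      simp only [powDefect]
      rw [Finset.sum_Icc_succ_top (by omega : 1 ≤ k + 1 + 1)]
      have hsplit : ∀ n : ℕ, n ≠ 0 → (n : ℂ) ^ (1 - s) = n * (n : ℂ) ^ (-s) := by
        intro n hn
        rw [sub_eq_add_neg, Complex.cpow_add _ _ (Nat.cast_ne_zero.2 hn), Complex.cpow_one]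
      rw [hsplit _ (Nat.succ_ne_zero (k + 1)), hsplit _ (Nat.succ_ne_zero k)]
      push_cast
      field_simp
      ring
  have hlim : Tendsto (fun k : ℕ => ∫ t in (1 : ℝ)..((k + 1 : ℕ) : ℝ),
      (t : ℂ) ^ (-s - 1) * ((Int.fract t : ℝ) : ℂ)) atTop (𝓝 (mellin fractTail (-s))) := by
    rw [mellin_fractTail]
    exact intervalIntegral_tendsto_integral_Ioi 1 hint
      (tendsto_natCast_atTop_atTop.comp (tendsto_add_atTop_nat 1))
  rw [← tendsto_add_atTop_iff_nat 1]
  simp_rw [hI]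
  have : -riemannZeta s = s / (1 - s) + s * mellin fractTail (-s) := by
    rw [riemannZeta_eq_of_mem_strip hs0 hs1]; field_simp; ring
  rw [this]
  exact tendsto_const_nhds.add (tendsto_const_nhds.mul hlim)

/-- On (0, 1) one has {t} = t, which contributes 1/(1-s) and absorbs the rational term of the strip
formula. -/
theorem mellin_fract {s : ℂ} (hs0 : 0 < s.re) (hs1 : s.re < 1) :
    MellinConvergent (fun t : ℝ => ((Int.fract t : ℝ) : ℂ)) (-s) ∧
    mellin (fun t : ℝ => ((Int.fract t : ℝ) : ℂ)) (-s) = -riemannZeta s / s := by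
  have h0 : s ≠ 0 := fun h => by simp [h] at hs0
  have h1 : s ≠ 1 := fun h => by simp [h] at hs1
  have h1' : 1 - s ≠ 0 := sub_ne_zero.2 (Ne.symm h1)
  have h1'' : s - 1 ≠ 0 := sub_ne_zero.2 h1
  have heq : EqOn (fun t : ℝ => (t : ℂ) ^ (-s)) (fun t : ℝ => (t : ℂ) ^ (-s - 1) •
      ((Int.fract t : ℝ) : ℂ)) (Ioo 0 1) := by
    intro t ht
    have e1 : (t : ℂ) ^ (-s) = t * (t : ℂ) ^ (-s - 1) := by
      rw [show -s = (-s - 1) + 1 by ring, Complex.cpow_add _ _ (by exact_mod_cast ht.1.ne'),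
        Complex.cpow_one, mul_comm]
      simp
    simp only [smul_eq_mul, e1, Int.fract_eq_self.2 ⟨ht.1.le, ht.2⟩]
    ring
  have i1 : IntervalIntegrable (fun t : ℝ => (t : ℂ) ^ (-s)) volume 0 1 :=
    intervalIntegral.intervalIntegrable_cpow' (by simpa using hs1)
  have i2 : IntegrableOn (fun t : ℝ => (t : ℂ) ^ (-s - 1) • ((Int.fract t : ℝ) : ℂ)) (Ioc 0 1) := by
    rw [integrableOn_Ioc_iff_integrableOn_Ioo]
    refine IntegrableOn.congr_fun ?_ heq measurableSet_Ioo
    rw [← integrableOn_Ioc_iff_integrableOn_Ioo]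
    exact (intervalIntegrable_iff_integrableOn_Ioc_of_le zero_le_one).1 i1
  have i3 := integrableOn_cpow_mul_fract (w := -s) (by simpa using hs0)
  have hu : Ioi (0 : ℝ) = Ioc 0 1 ∪ Ioi 1 := (Ioc_union_Ioi_eq_Ioi zero_le_one).symm
  refine ⟨by rw [MellinConvergent, hu]; exact i2.union i3, ?_⟩
  have v : ∫ t in Ioc (0 : ℝ) 1, (t : ℂ) ^ (-s - 1) • ((Int.fract t : ℝ) : ℂ) = 1 / (1 - s) := by
    rw [integral_Ioc_eq_integral_Ioo, ← setIntegral_congr_fun measurableSet_Ioo heq,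
      ← integral_Ioc_eq_integral_Ioo, ← intervalIntegral.integral_of_le zero_le_one,
      integral_cpow (Or.inl (by simpa using hs1))]
    rw [show -s + 1 = 1 - s by ring]
    simp [Complex.zero_cpow h1']
  have v2 := mellin_fractTail (-s)
  rw [mellin, hu, setIntegral_union (Ioc_disjoint_Ioi le_rfl) measurableSet_Ioi i2 i3, v]
  simp only [smul_eq_mul]
  rw [← v2, riemannZeta_eq_of_mem_strip hs0 hs1]
  field_simp; ring

/-- On the open unit interval the Riemann zeta function is negative. -/
theorem riemannZeta_re_neg_of_mem_Ioo {D : ℝ} (h0 : 0 < D) (h1 : D < 1) :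
    (riemannZeta D).re < 0 := by
  obtain ⟨hc, hm⟩ := mellin_fract (s := D) (by simpa using h0) (by simpa using h1)
  have e : EqOn (fun t : ℝ => (t : ℂ) ^ (-(D : ℂ) - 1) • ((Int.fract t : ℝ) : ℂ))
      (fun t : ℝ => ((t ^ (-D - 1) * Int.fract t : ℝ) : ℂ)) (Ioi 0) := by
    intro t ht
    simp only [smul_eq_mul]
    push_cast
    rw [Complex.ofReal_cpow (le_of_lt ht)]
    push_cast; rfl
  have hr : mellin (fun t : ℝ => ((Int.fract t : ℝ) : ℂ)) (-D) =
      ((∫ t in Ioi (0 : ℝ), t ^ (-D - 1) * Int.fract t : ℝ) : ℂ) := by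
    rw [mellin, setIntegral_congr_fun measurableSet_Ioi e]
    exact integral_ofReal
  have hi : IntegrableOn (fun t : ℝ => t ^ (-D - 1) * Int.fract t) (Ioi 0) := by
    simpa [IntegrableOn] using Integrable.re (IntegrableOn.congr_fun hc e measurableSet_Ioi)
  -- ζ(D) is -D times this integral, whose integrand is nonnegative and is positive on (0, 1).
  have hpos : 0 < ∫ t in Ioi (0 : ℝ), t ^ (-D - 1) * Int.fract t := by
    rw [setIntegral_pos_iff_support_of_nonneg_ae _ hi]
    · refine lt_of_lt_of_le ?_ (measure_mono (show Ioo (0 : ℝ) 1 ⊆ _ from fun t ht => ⟨?_, ht.1⟩))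
      · simp
      · have := Int.fract_eq_self.2 ⟨ht.1.le, ht.2⟩
        simp only [Function.mem_support, this]
        have := ht.1
        positivity
    · filter_upwards [ae_restrict_mem measurableSet_Ioi] with t ht
      have : (0 : ℝ) < t := ht
      have := Int.fract_nonneg t
      simp only [Pi.zero_apply]; positivity
  rw [hr] at hm
  have hD : (D : ℂ) ≠ 0 := by exact_mod_cast h0.ne'
  rw [eq_div_iff hD] at hm
  have := congrArg Complex.re hm
  rw [← Complex.ofReal_mul, Complex.ofReal_re, Complex.neg_re] at this
  nlinarith

/-! ### Kernels with smooth, compactly supported Fourier transform -/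

theorem integrable_fourierInv_of_smooth {l : ℝ → ℂ} (hl : ContDiff ℝ ∞ l)
    (hc : HasCompactSupport l) : Integrable (𝓕⁻ l) := by
  have := (𝓕⁻ (hc.toSchwartzMap hl)).integrable (μ := volume)
  rw [SchwartzMap.fourierInv_coe] at this
  exact this

theorem integral_fourierInv_of_smooth {l : ℝ → ℂ} (hl : ContDiff ℝ ∞ l)
    (hc : HasCompactSupport l) : ∫ x, 𝓕⁻ l x = l 0 := by
  have h1 : Integrable l := hl.continuous.integrable_of_hasCompactSupport hc
  have h2 : Integrable (𝓕 l) := by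
    have := (𝓕 (hc.toSchwartzMap hl)).integrable (μ := volume)
    rw [SchwartzMap.fourier_coe] at this
    exact this
  have h3 := congrFun (hl.continuous.fourier_fourierInv_eq h1 h2) 0
  rw [← h3, Real.fourier_real_eq]
  simp

/-- Convolution against an inverse Fourier transform. -/
theorem integral_mul_fourierInv_sub {K m : ℝ → ℂ} (hK : Integrable K) (hm : Integrable m) (u : ℝ) :
    ∫ v, K v * 𝓕⁻ m (u - v) = ∫ ξ, 𝓕 K ξ * (m ξ * 𝐞 (ξ * u)) := by
  have hg : Integrable (fun ξ => m ξ * 𝐞 (ξ * u)) := by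
    refine hm.mul_bdd (c := 1) ?_ (ae_of_all _ fun ξ => (Circle.norm_coe _).le)
    have : Continuous fun ξ : ℝ => ((𝐞 (ξ * u) : Circle) : ℂ) := by
      have := Real.continuous_fourierChar
      fun_prop
    exact this.aestronglyMeasurable
  -- Self-adjointness of the Fourier transform, against the modulated function m(ξ) e^(2πiξu).
  have h := VectorFourier.integral_fourierIntegral_smul_eq_flip (L := innerₗ ℝ)
      Real.continuous_fourierChar continuous_inner hK hg
  have h2 : ∀ v, VectorFourier.fourierIntegral 𝐞 volume (innerₗ ℝ).flip
      (fun ξ => m ξ * 𝐞 (ξ * u)) v = 𝓕⁻ m (u - v) := by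
    intro v
    rw [VectorFourier.fourierIntegral, Real.fourierInv_eq]
    refine integral_congr_ae (ae_of_all _ fun ξ => ?_)
    simp only [LinearMap.flip_apply, innerₗ_apply_apply, Circle.smul_def, smul_eq_mul]
    rw [show inner ℝ ξ (u - v) = ξ * u + -(inner ℝ v ξ) by simp [inner]; ring, AddChar.map_add_eq_mul]
    push_cast; ring
  simp_rw [h2] at h
  rw [← show _ = ∫ v, K v * 𝓕⁻ m (u - v) from h.trans rfl]
  rfl

theorem fourierInv_comp_div (l : ℝ → ℂ) {r : ℝ} (hr : 0 < r) (x : ℝ) :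
    𝓕⁻ (fun y => l (y / r)) x = r * 𝓕⁻ l (r * x) := by
  rw [Real.fourierInv_eq, Real.fourierInv_eq]
  have := Measure.integral_comp_div (fun y => 𝐞 (inner ℝ y (r * x)) • l y) r
  rw [abs_of_pos hr, Complex.real_smul] at this
  rw [← this]
  refine integral_congr_ae (ae_of_all _ fun y => ?_)
  have : inner ℝ y x = inner ℝ (y / r) (r * x) := by
    simp only [RCLike.inner_apply, conj_trivial]
    field_simp
  simp only [this]

/-- There is a nonnegative integrable kernel of mass `1` whose Fourier transform is smooth and
compactly supported. -/
theorem exists_kernel_smooth_fourier : ∃ (l : ℝ → ℂ) (k : ℝ → ℝ), ContDiff ℝ ∞ l ∧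
    HasCompactSupport l ∧ (∀ x, 𝓕⁻ l x = k x) ∧ (∀ x, 0 ≤ k x) ∧ Integrable k ∧
    ∫ x, k x = 1 ∧ l 0 = 1 := by
  let φ : ContDiffBump (0 : ℝ) := ⟨1, 2, one_pos, one_lt_two⟩
  let b : ℝ → ℂ := fun x => (φ x : ℂ)
  have hb : ContDiff ℝ ∞ b := Complex.ofRealCLM.contDiff.comp φ.contDiff
  have hbc : HasCompactSupport b := φ.hasCompactSupport.comp_left Complex.ofReal_zero
  have hbi : Integrable b := hb.continuous.integrable_of_hasCompactSupport hbc
  -- The transform of b ∗ b is a square, and it is the square of a real function because b is real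
  -- and even: hence a nonnegative kernel.
  let l : ℝ → ℂ := convolution b b (ContinuousLinearMap.mul ℂ ℂ) volume
  have hl : ContDiff ℝ ∞ l := by
    have : ContDiff ℝ ∞ (convolution b b (ContinuousLinearMap.mul ℝ ℂ) volume) :=
      hbc.contDiff_convolution_left (n := ⊤) _ hb hbi.locallyIntegrable
    exact this
  have hlc : HasCompactSupport l := hbc.convolution _ hbc
  have hconj : ∀ x, (starRingEnd ℂ) (𝓕 b x) = 𝓕 b x := by
    intro x
    rw [Real.fourier_real_eq_integral_exp_smul, ← integral_conj]
    conv_rhs => rw [← integral_neg_eq_self]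
    refine integral_congr_ae (ae_of_all _ fun y => ?_)
    simp only [smul_eq_mul, map_mul, ← Complex.exp_conj, Complex.conj_ofReal, Complex.conj_I, b,
      φ.neg]
    congr 2
    push_cast; ring
  have hre : ∀ x, 𝓕 b x = ((𝓕 b x).re : ℂ) := fun x => (Complex.conj_eq_iff_re.1 (hconj x)).symm
  have hk : ∀ x, 𝓕⁻ l x = (((𝓕 b (-x)).re ^ 2 : ℝ) : ℂ) := by
    intro x
    rw [Real.fourierInv_eq_fourier_neg, Real.fourier_mul_convolution_eq hbi hbi, hre]
    push_cast
    rw [Complex.ofReal_re]; ring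
  have hi := integrable_fourierInv_of_smooth hl hlc
  have hk' : Integrable (fun x => (𝓕 b (-x)).re ^ 2) := by
    have := hi.re
    refine this.congr (ae_of_all _ fun x => ?_)
    simp only [hk, RCLike.re_to_complex, Complex.ofReal_re]
  have hint := integral_fourierInv_of_smooth hl hlc
  simp_rw [hk] at hint
  have hint' : ((∫ x, (𝓕 b (-x)).re ^ 2 : ℝ) : ℂ) = l 0 := by rw [← hint]; exact integral_ofReal.symm
  have hl0 : l 0 = ((∫ t, φ t ^ 2 : ℝ) : ℂ) := by
    rw [← integral_complex_ofReal]
    refine integral_congr_ae (ae_of_all _ fun t => ?_)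
    simp [b, φ.neg, sq]
  have hpos : 0 < ∫ t, φ t ^ 2 := by
    refine Continuous.integral_pos_of_hasCompactSupport_nonneg_nonzero (x := 0)
      (by have := φ.continuous; fun_prop) ?_ (fun t => sq_nonneg _) ?_
    · have : (fun t => φ t ^ 2) = fun t => (φ t) * φ t := by ext; ring
      rw [this]; exact φ.hasCompactSupport.mul_left
    · rw [φ.one_of_mem_closedBall (by simp [φ])]; norm_num
  set c := ∫ t, φ t ^ 2 with hcdef
  have hc0 : (c : ℂ) ≠ 0 := by exact_mod_cast hpos.ne'
  have hint2 : ∫ x, (𝓕 b (-x)).re ^ 2 = c := by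
    rw [hl0] at hint'; exact_mod_cast hint'
  refine ⟨fun x => (c : ℂ)⁻¹ * l x, fun x => c⁻¹ * (𝓕 b (-x)).re ^ 2, contDiff_const.mul hl,
    hlc.mul_left, fun x => ?_, fun x => by positivity, hk'.const_mul _, ?_, ?_⟩
  · have : 𝓕⁻ (fun x => (c : ℂ)⁻¹ * l x) x = (c : ℂ)⁻¹ * 𝓕⁻ l x := by
      rw [Real.fourierInv_eq, Real.fourierInv_eq, ← integral_const_mul]
      refine integral_congr_ae (ae_of_all _ fun t => ?_)
      simp only [Circle.smul_def, smul_eq_mul]; ring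
    rw [this, hk]; push_cast; rfl
  · rw [integral_const_mul, hint2, inv_mul_cancel₀ hpos.ne']
  · simp only [hl0]; exact inv_mul_cancel₀ hc0

theorem tendsto_integral_compl_Icc {k : ℝ → ℝ} (hk : Integrable k) {δ : ℝ} (hδ : 0 < δ) :
    Tendsto (fun n : ℕ => ∫ x in (Icc (-((n : ℝ) * δ)) (n * δ))ᶜ, k x) atTop (𝓝 0) := by
  simp_rw [← integral_indicator (measurableSet_Icc.compl)]
  rw [show (0 : ℝ) = ∫ x : ℝ, (0 : ℝ) by simp]
  refine tendsto_integral_of_dominated_convergence (fun x => ‖k x‖) (fun n =>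
    (hk.indicator measurableSet_Icc.compl).aestronglyMeasurable) hk.norm
    (fun n => ae_of_all _ fun x => norm_indicator_le_norm_self _ _) (ae_of_all _ fun x => ?_)
  have h : ∀ᶠ n : ℕ in atTop, |x| ≤ n * δ :=
    (tendsto_natCast_atTop_atTop.atTop_mul_const hδ).eventually_ge_atTop _
  refine tendsto_const_nhds.congr' ?_
  filter_upwards [h] with n hn
  rw [indicator_of_notMem]
  simpa using ⟨(abs_le.1 hn).1, (abs_le.1 hn).2⟩

/-- Rescaling k to n k(n·) concentrates its mass near 0, and only dilates l, whose value at 0 is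
unchanged. -/
theorem exists_concentrated_kernel {δ η : ℝ} (hδ : 0 < δ) (hη : 0 < η) :
    ∃ (l : ℝ → ℂ) (k : ℝ → ℝ), ContDiff ℝ ∞ l ∧
    HasCompactSupport l ∧ (∀ x, 𝓕⁻ l x = k x) ∧ (∀ x, 0 ≤ k x) ∧ Integrable k ∧
    ∫ x, k x = 1 ∧ l 0 = 1 ∧ ∫ x in (Icc (-δ) δ)ᶜ, k x ≤ η := by
  obtain ⟨l, k, hl, hlc, hlk, hk0, hki, hk1, hl0⟩ := exists_kernel_smooth_fourier
  obtain ⟨n, hn, hn1⟩ := (((tendsto_integral_compl_Icc hki hδ).eventually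
    (gt_mem_nhds hη)).and (eventually_ge_atTop 1)).exists
  have hn0 : (0 : ℝ) < n := by exact_mod_cast hn1
  refine ⟨fun y => l (y / n), fun x => n * k (n * x), hl.comp (contDiff_id.div_const _), ?_,
    fun x => ?_, fun x => mul_nonneg hn0.le (hk0 _), (hki.comp_mul_left' hn0.ne').const_mul _, ?_,
    by simpa using hl0, ?_⟩
  · exact by
      simpa only [div_eq_inv_mul, smul_eq_mul] using
        hlc.comp_smul (inv_ne_zero hn0.ne')
  · rw [fourierInv_comp_div l hn0, hlk]; push_cast; rfl
  · rw [integral_const_mul, Measure.integral_comp_mul_left, abs_of_pos (inv_pos.2 hn0), hk1]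
    simp [hn0.ne']
  · have h := Measure.integral_comp_mul_left
      ((Icc (-((n : ℝ) * δ)) (n * δ))ᶜ.indicator k) (n : ℝ)
    rw [integral_indicator measurableSet_Icc.compl, abs_of_pos (inv_pos.2 hn0), smul_eq_mul] at h
    have e : ∫ x in (Icc (-δ) δ)ᶜ, (n : ℝ) * k (n * x) =
        n * ∫ x, (Icc (-((n : ℝ) * δ)) (n * δ))ᶜ.indicator k (n * x) := by
      rw [← integral_const_mul, ← integral_indicator measurableSet_Icc.compl]
      refine integral_congr_ae (ae_of_all _ fun x => ?_)
      have : x ∈ (Icc (-δ) δ)ᶜ ↔ (n : ℝ) * x ∈ (Icc (-((n : ℝ) * δ)) (n * δ))ᶜ := by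
        rw [not_iff_not.symm]
        simp only [mem_compl_iff, not_not, mem_Icc]
        rw [← mul_neg, mul_le_mul_iff_right₀ hn0, mul_le_mul_iff_right₀ hn0]
      beta_reduce
      by_cases hx : x ∈ (Icc (-δ) δ)ᶜ
      · rw [indicator_of_mem hx, indicator_of_mem (this.1 hx)]
      · rw [indicator_of_notMem hx, indicator_of_notMem (fun h => hx (this.2 h)), mul_zero]
    rw [e, h, ← mul_assoc, mul_inv_cancel₀ hn0.ne', one_mul]
    exact hn.le

/-! ### From convergence of averages to pointwise convergence -/

/-- A Tauberian lemma: a bounded slowly decreasing function whose averages against all kernels with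
smooth compactly supported Fourier transform converge is itself convergent. -/
theorem tendsto_of_tendsto_averages {h : ℝ → ℝ} {D A B : ℝ} (hD : 0 < D) (hm : Measurable h)
    (h0 : ∀ t, 0 ≤ h t) (hB : ∀ t, h t ≤ B)
    (hmono : ∀ s t, s ≤ t → h s * Real.exp (D * s) ≤ h t * Real.exp (D * t))
    (H : ∀ l : ℝ → ℂ, ContDiff ℝ ∞ l → HasCompactSupport l →
      Tendsto (fun u => ∫ t, (h t : ℂ) * 𝓕⁻ l (u - t)) atTop (𝓝 (A * l 0))) :
    Tendsto h atTop (𝓝 A) := by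
  have hB0 : 0 ≤ B := (h0 0).trans (hB 0)
  -- Slow decrease: since h(t) e^(Dt) is monotone, h loses at most a factor e^(-2Dδ) over a length
  -- 2δ.
  have hslow : ∀ s t δ, s ≤ t → t ≤ s + 2 * δ → Real.exp (-(2 * D * δ)) * h s ≤ h t := by
    intro s t δ hst htd
    have h1 := hmono s t hst
    have h2 : Real.exp (D * t) ≤ Real.exp (2 * D * δ) * Real.exp (D * s) := by
      rw [← Real.exp_add]; exact Real.exp_le_exp.2 (by nlinarith)
    have h3 : h s * Real.exp (D * s) ≤ h t * Real.exp (2 * D * δ) * Real.exp (D * s) := by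
      rw [mul_assoc]
      exact h1.trans (mul_le_mul_of_nonneg_left h2 (h0 t))
    have h4 := le_of_mul_le_mul_right h3 (Real.exp_pos _)
    rw [Real.exp_neg, inv_mul_le_iff₀ (Real.exp_pos _), mul_comm]
    exact h4
  -- The kernel has mass at least 1 - δ on [-δ, δ]. Centred at u + δ it samples h on [u, u + 2δ],
  -- which bounds h(u) above; centred at u - δ it samples [u - 2δ, u], which bounds h(u) below, the
  -- escaped mass costing at most Bδ.
  have key : ∀ δ > 0, ∀ᶠ u in atTop,
      Real.exp (-(2 * D * δ)) * h u * (1 - δ) ≤ A + δ ∧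
      Real.exp (-(2 * D * δ)) * (A - δ - B * δ) ≤ h u := by
    intro δ hδ
    obtain ⟨l, k, hl, hlc, hlk, hk0, hki, hk1, hl0, hkδ⟩ := exists_concentrated_kernel hδ hδ
    have hint : ∀ u, Integrable fun v => h (u - v) * k v := by
      intro u
      refine hki.bdd_mul (c := B) (hm.comp (by fun_prop)).aestronglyMeasurable
        (ae_of_all _ fun v => ?_)
      rw [Real.norm_of_nonneg (h0 _)]; exact hB _
    have hG : Tendsto (fun u => ∫ v, h (u - v) * k v) atTop (𝓝 A) := by
      have h1 := (Complex.continuous_re.tendsto _).comp (H l hl hlc)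
      rw [hl0, mul_one, Complex.ofReal_re] at h1
      refine h1.congr fun u => ?_
      simp only [Function.comp, hlk]
      rw [← integral_sub_left_eq_self (fun v => h (u - v) * k v) volume u]
      rw [← Complex.ofReal_re (∫ v, _)]
      congr 1
      rw [← integral_complex_ofReal]
      refine integral_congr_ae (ae_of_all _ fun v => ?_)
      simp
    have hsplit : ∫ v in Icc (-δ) δ, k v = 1 - ∫ v in (Icc (-δ) δ)ᶜ, k v := by
      rw [← hk1, ← integral_add_compl measurableSet_Icc hki]; ring
    have hb1 : ∀ u, Real.exp (-(2 * D * δ)) * h u * (1 - δ) ≤ ∫ v, h (u + δ - v) * k v := by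
      intro u
      calc Real.exp (-(2 * D * δ)) * h u * (1 - δ)
          ≤ Real.exp (-(2 * D * δ)) * h u * ∫ v in Icc (-δ) δ, k v :=
            mul_le_mul_of_nonneg_left (by rw [hsplit]; linarith)
              (mul_nonneg (Real.exp_pos _).le (h0 _))
        _ = ∫ v in Icc (-δ) δ, Real.exp (-(2 * D * δ)) * h u * k v := by
            rw [integral_const_mul]
        _ ≤ ∫ v in Icc (-δ) δ, h (u + δ - v) * k v := by
            refine setIntegral_mono_on (hki.integrableOn.const_mul _) (hint _).integrableOn
              measurableSet_Icc fun v hv => ?_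
            exact mul_le_mul_of_nonneg_right (hslow _ _ _ (by linarith [hv.2]) (by linarith [hv.1]))
              (hk0 v)
        _ ≤ _ := setIntegral_le_integral (hint _)
            (ae_of_all _ fun v => mul_nonneg (h0 _) (hk0 _))
    have hb2 : ∀ u, Real.exp (-(2 * D * δ)) * ((∫ v, h (u - δ - v) * k v) - B * δ) ≤ h u := by
      intro u
      rw [Real.exp_neg, inv_mul_le_iff₀ (Real.exp_pos _)]
      rw [← integral_add_compl (s := Icc (-δ) δ) measurableSet_Icc (hint _)]
      have e1 : ∫ v in Icc (-δ) δ, h (u - δ - v) * k v ≤ Real.exp (2 * D * δ) * h u := by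
        calc _ ≤ ∫ v in Icc (-δ) δ, Real.exp (2 * D * δ) * h u * k v := by
              refine setIntegral_mono_on (hint _).integrableOn (hki.integrableOn.const_mul _)
                measurableSet_Icc fun v hv => mul_le_mul_of_nonneg_right ?_ (hk0 v)
              have := hslow (u - δ - v) u δ (by linarith [hv.1]) (by linarith [hv.2])
              rwa [Real.exp_neg, inv_mul_le_iff₀ (Real.exp_pos _)] at this
          _ = Real.exp (2 * D * δ) * h u * ∫ v in Icc (-δ) δ, k v := by rw [integral_const_mul]
          _ ≤ Real.exp (2 * D * δ) * h u * 1 := by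
              refine mul_le_mul_of_nonneg_left ?_ (mul_nonneg (Real.exp_pos _).le (h0 _))
              rw [hsplit]
              have : 0 ≤ ∫ v in (Icc (-δ) δ)ᶜ, k v := integral_nonneg fun v => hk0 v
              linarith
          _ = _ := mul_one _
      have e2 : ∫ v in (Icc (-δ) δ)ᶜ, h (u - δ - v) * k v ≤ B * δ := by
        calc _ ≤ ∫ v in (Icc (-δ) δ)ᶜ, B * k v := by
              refine setIntegral_mono_on (hint _).integrableOn (hki.integrableOn.const_mul _)
                measurableSet_Icc.compl fun v hv => mul_le_mul_of_nonneg_right (hB _) (hk0 v)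
          _ = B * ∫ v in (Icc (-δ) δ)ᶜ, k v := by rw [integral_const_mul]
          _ ≤ _ := mul_le_mul_of_nonneg_left hkδ hB0
      linarith
    have l1 := (hG.comp (tendsto_atTop_add_const_right _ δ tendsto_id)).eventually
      (gt_mem_nhds (show A < A + δ by linarith))
    have l2 := (hG.comp (tendsto_atTop_add_const_right _ (-δ) tendsto_id)).eventually
      (lt_mem_nhds (show A - δ < A by linarith))
    filter_upwards [l1, l2] with u h1 h2
    simp only [Function.comp, id, ← sub_eq_add_neg] at h1 h2
    refine ⟨(hb1 u).trans h1.le, le_trans ?_ (hb2 u)⟩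
    refine mul_le_mul_of_nonneg_left ?_ (Real.exp_pos _).le
    linarith
  rw [tendsto_order]
  constructor
  · intro a ha
    have hc : Tendsto (fun δ : ℝ => Real.exp (-(2 * D * δ)) * (A - δ - B * δ)) (𝓝[>] 0) (𝓝 A) := by
      have : Continuous fun δ : ℝ => Real.exp (-(2 * D * δ)) * (A - δ - B * δ) := by fun_prop
      simpa using (this.tendsto 0).mono_left nhdsWithin_le_nhds
    obtain ⟨δ, hδa, hδ⟩ := ((hc.eventually (lt_mem_nhds ha)).and self_mem_nhdsWithin).exists
    filter_upwards [key δ hδ] with u hu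
    exact hδa.trans_le hu.2
  · intro a ha
    have hc : Tendsto (fun δ : ℝ => a * (Real.exp (-(2 * D * δ)) * (1 - δ)) - (A + δ)) (𝓝[>] 0)
        (𝓝 (a - A)) := by
      have : Continuous fun δ : ℝ => a * (Real.exp (-(2 * D * δ)) * (1 - δ)) - (A + δ) := by fun_prop
      simpa using (this.tendsto 0).mono_left nhdsWithin_le_nhds
    obtain ⟨δ, hδa, hδ⟩ := ((hc.eventually (lt_mem_nhds (sub_pos.2 ha))).and
      (Ioo_mem_nhdsGT (show (0 : ℝ) < 1 by norm_num))).exists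
    filter_upwards [key δ hδ.1] with u hu
    by_contra! hcon
    have hpos : 0 < Real.exp (-(2 * D * δ)) * (1 - δ) :=
      mul_pos (Real.exp_pos _) (by linarith [hδ.2])
    nlinarith [hu.1, mul_le_mul_of_nonneg_right hcon hpos.le]

/-! ### The two kernels and Wiener's division by zeta -/

/-- The Fourier kernel attached to the fractional part. -/
noncomputable def fractKernel (D v : ℝ) : ℝ := Int.fract (Real.exp v) * Real.exp (-(D * v))

/-- The one-sided exponential kernel. -/
noncomputable def stepKernel (D v : ℝ) : ℝ := (Ici (0 : ℝ)).indicator (fun v => Real.exp (-(D * v))) v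

theorem measurable_fractKernel (D : ℝ) : Measurable (fractKernel D) :=
  (measurable_fract.comp Real.measurable_exp).mul (by fun_prop)

theorem measurable_stepKernel (D : ℝ) : Measurable (stepKernel D) :=
  Measurable.indicator (by fun_prop) measurableSet_Ici

theorem fractKernel_nonneg (D v : ℝ) : 0 ≤ fractKernel D v :=
  mul_nonneg (Int.fract_nonneg _) (Real.exp_pos _).le

theorem stepKernel_nonneg (D v : ℝ) : 0 ≤ stepKernel D v :=
  indicator_nonneg (fun _ _ => (Real.exp_pos _).le) _

/-- {x} ≤ x gives decay e^((1-D)v) on the left, and {x} < 1 gives e^(-Dv) on the right. -/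
theorem integrable_fractKernel {D : ℝ} (h0 : 0 < D) (h1 : D < 1) :
    Integrable (fractKernel D) := by
  rw [← integrableOn_univ, ← Iic_union_Ioi (a := (0 : ℝ))]
  refine IntegrableOn.union ?_ ?_
  · refine Integrable.mono' (integrableOn_exp_mul_Iic (a := 1 - D) (by linarith) 0)
      (measurable_fractKernel D).aestronglyMeasurable (ae_of_all _ fun v => ?_)
    rw [Real.norm_of_nonneg (fractKernel_nonneg _ _), fractKernel]
    calc _ ≤ Real.exp v * Real.exp (-(D * v)) := by
          refine mul_le_mul_of_nonneg_right ?_ (Real.exp_pos _).le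
          have := Int.floor_nonneg.2 (Real.exp_pos v).le
          rw [Int.fract, sub_le_self_iff]; exact_mod_cast this
      _ = _ := by rw [← Real.exp_add]; ring_nf
  · refine Integrable.mono' (integrableOn_exp_mul_Ioi (a := -D) (by linarith) 0)
      (measurable_fractKernel D).aestronglyMeasurable (ae_of_all _ fun v => ?_)
    rw [Real.norm_of_nonneg (fractKernel_nonneg _ _), fractKernel]
    calc _ ≤ 1 * Real.exp (-(D * v)) :=
          mul_le_mul_of_nonneg_right (Int.fract_lt_one _).le (Real.exp_pos _).le
      _ = _ := by rw [one_mul]; ring_nf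

theorem integrable_stepKernel {D : ℝ} (h0 : 0 < D) : Integrable (stepKernel D) := by
  unfold stepKernel
  rw [integrable_indicator_iff measurableSet_Ici, integrableOn_Ici_iff_integrableOn_Ioi]
  simpa using integrableOn_exp_mul_Ioi (a := -D) (by linarith) 0

theorem fourier_fractKernel {D : ℝ} (h0 : 0 < D) (h1 : D < 1) (ξ : ℝ) :
    𝓕 (fun v => (fractKernel D v : ℂ)) ξ =
      -riemannZeta (D + 2 * Real.pi * ξ * Complex.I) / (D + 2 * Real.pi * ξ * Complex.I) := by
  set s : ℂ := D + 2 * Real.pi * ξ * Complex.I with hs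
  have hre : s.re = D := by simp [hs]
  have him : s.im = 2 * Real.pi * ξ := by simp [hs]
  rw [← (mellin_fract (s := s) (by rwa [hre]) (by rwa [hre])).2, mellin_eq_fourier]
  have e : (-s).im / (2 * Real.pi) = -ξ := by
    rw [Complex.neg_im, him]; field_simp
  -- `mellin_eq_fourier` substitutes t = e^(-v), whereas the kernel uses e^v; the sign of ξ
  -- compensates the reflection.
  rw [e, ← Real.fourierInv_eq_fourier_neg, Real.fourierInv_eq_fourier_comp_neg]
  refine congrArg (fun F : ℝ → ℂ => 𝓕 F ξ) (funext fun v => ?_)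
  simp only [fractKernel, Complex.neg_re, hre, neg_neg, Complex.real_smul]
  push_cast
  rw [mul_comm]; congr 2; ring

theorem fourier_stepKernel {D : ℝ} (h0 : 0 < D) (ξ : ℝ) :
    𝓕 (fun v => (stepKernel D v : ℂ)) ξ = 1 / (D + 2 * Real.pi * ξ * Complex.I) := by
  have hs : (D + 2 * Real.pi * ξ * Complex.I : ℂ) ≠ 0 := fun h => by
    have := congrArg Complex.re h; simp at this; linarith
  rw [Real.fourier_real_eq_integral_exp_smul]
  have e : ∀ v : ℝ, Complex.exp (↑(-2 * Real.pi * v * ξ) * Complex.I) • (stepKernel D v : ℂ) =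
      (Ici (0 : ℝ)).indicator
        (fun v : ℝ => Complex.exp (-(D + 2 * Real.pi * ξ * Complex.I) * v)) v := by
    intro v
    by_cases hv : v ∈ Ici (0 : ℝ)
    · simp only [stepKernel, indicator_of_mem hv, smul_eq_mul]
      push_cast
      rw [← Complex.exp_add]; ring_nf
    · simp [stepKernel, indicator_of_notMem hv]
  simp_rw [e]
  rw [integral_indicator measurableSet_Ici, integral_Ici_eq_integral_Ioi,
    integral_exp_mul_complex_Ioi (by simpa using h0)]
  simp only [Complex.ofReal_zero, mul_zero, Complex.exp_zero]
  rw [div_neg, neg_div, neg_neg]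

/-- Sum and integral may be exchanged because the summands a_j κ(t - p_j) are nonnegative with
bounded sum, so B‖M‖ dominates. -/
theorem integral_hasSum_translates {ι : Type*} [Countable ι] {a p : ι → ℝ} (ha : ∀ j, 0 ≤ a j)
    {κ g : ℝ → ℝ} (hκ0 : ∀ v, 0 ≤ κ v) (hκm : Measurable κ)
    (hg : ∀ t, HasSum (fun j => a j * κ (t - p j)) (g t)) {B : ℝ} (hB : ∀ t, g t ≤ B)
    {M : ℝ → ℂ} (hM : Integrable M) (u : ℝ) :
    ∫ t, (g t : ℂ) * M (u - t) = ∑' j, (a j : ℂ) * ∫ v, (κ v : ℂ) * M (u - p j - v) := by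
  have hMu : Integrable fun t => M (u - t) := hM.comp_sub_left u
  have e1 : ∀ t, (g t : ℂ) * M (u - t) = ∑' j, ((a j * κ (t - p j) : ℝ) : ℂ) * M (u - t) := by
    intro t
    rw [tsum_mul_right, ← Complex.ofReal_tsum, (hg t).tsum_eq]
  simp_rw [e1]
  rw [integral_tsum]
  · refine tsum_congr fun j => ?_
    rw [← integral_const_mul, ← integral_add_right_eq_self _ (p j)]
    refine integral_congr_ae (ae_of_all _ fun v => ?_)
    simp only [add_sub_cancel_right]
    push_cast
    rw [show u - (v + p j) = u - p j - v by ring, mul_assoc]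
  · intro j
    refine AEStronglyMeasurable.mul ?_ hMu.aestronglyMeasurable
    exact (Complex.measurable_ofReal.comp
      ((hκm.comp (by fun_prop)).const_mul _)).aestronglyMeasurable
  · have hle : ∑' j, ∫⁻ t, ‖((a j * κ (t - p j) : ℝ) : ℂ) * M (u - t)‖ₑ ≤
        ∫⁻ t, ENNReal.ofReal B * ‖M (u - t)‖ₑ := by
      rw [← lintegral_tsum]
      · refine lintegral_mono fun t => ?_
        simp_rw [enorm_mul]
        rw [ENNReal.tsum_mul_right]
        gcongr
        have : ∀ j, ‖((a j * κ (t - p j) : ℝ) : ℂ)‖ₑ = ENNReal.ofReal (a j * κ (t - p j)) := by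
          intro j
          rw [← ofReal_norm, Complex.norm_real, Real.norm_of_nonneg
            (mul_nonneg (ha j) (hκ0 _))]
        simp_rw [this]
        rw [← ENNReal.ofReal_tsum_of_nonneg (fun j => mul_nonneg (ha j) (hκ0 _)) (hg t).summable,
          (hg t).tsum_eq]
        exact ENNReal.ofReal_le_ofReal (hB t)
      · intro j
        refine AEMeasurable.enorm (AEMeasurable.mul ?_ hMu.aestronglyMeasurable.aemeasurable)
        exact (Complex.measurable_ofReal.comp
          ((hκm.comp (by fun_prop)).const_mul _)).aemeasurable
    refine ne_top_of_le_ne_top ?_ hle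
    rw [lintegral_const_mul' _ _ ENNReal.ofReal_ne_top]
    exact ENNReal.mul_ne_top ENNReal.ofReal_ne_top hMu.2.ne

theorem tendsto_integral_mul_of_tendsto {g : ℝ → ℝ} (hgm : Measurable g) {B C : ℝ}
    (hB : ∀ t, |g t| ≤ B) (hg : Tendsto g atTop (𝓝 C)) {M : ℝ → ℂ} (hM : Integrable M) :
    Tendsto (fun u => ∫ t, (g t : ℂ) * M (u - t)) atTop (𝓝 (C * ∫ v, M v)) := by
  have e : ∀ u, ∫ t, (g t : ℂ) * M (u - t) = ∫ v, (g (u - v) : ℂ) * M v := by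
    intro u
    rw [← integral_sub_left_eq_self (fun v => (g (u - v) : ℂ) * M v) volume u]
    simp
  simp_rw [e]
  rw [← integral_const_mul]
  refine tendsto_integral_filter_of_dominated_convergence (fun v => B * ‖M v‖)
    (Eventually.of_forall fun u => ?_) (Eventually.of_forall fun u => ae_of_all _ fun v => ?_)
    (hM.norm.const_mul _) (ae_of_all _ fun v => ?_)
  · exact (Complex.measurable_ofReal.comp (hgm.comp (by fun_prop))).aestronglyMeasurable.mul
      hM.aestronglyMeasurable
  · rw [norm_mul, Complex.norm_real]
    exact mul_le_mul_of_nonneg_right (hB _) (norm_nonneg _)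
  · refine Tendsto.mul_const _ ((Complex.continuous_ofReal.tendsto _).comp (hg.comp ?_))
    exact tendsto_atTop_add_const_right _ (-v) tendsto_id

theorem contDiff_zeta_vertical {D : ℝ} (h1 : D < 1) :
    ContDiff ℝ ∞ (fun ξ : ℝ => riemannZeta (D + 2 * Real.pi * ξ * Complex.I)) := by
  have hz : ContDiffOn ℂ ∞ riemannZeta {1}ᶜ :=
    DifferentiableOn.contDiffOn (fun s hs => (differentiableAt_riemannZeta hs).differentiableWithinAt)
      isOpen_compl_singleton
  have hz' : ContDiffOn ℝ ∞ riemannZeta {1}ᶜ := hz.restrict_scalars ℝ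
  have ha : ContDiff ℝ ∞ (fun ξ : ℝ => (D + 2 * Real.pi * ξ * Complex.I : ℂ)) := by
    have : ContDiff ℝ ∞ (fun ξ : ℝ => (ξ : ℂ)) := Complex.ofRealCLM.contDiff
    fun_prop
  refine hz'.comp_contDiff ha fun ξ h => ?_
  have := congrArg Complex.re (mem_singleton_iff.1 h)
  simp at this; linarith

/-- A Wiener type Tauberian theorem for the kernel of the fractional part. -/
theorem tendsto_of_tendsto_fract {ι : Type*} [Countable ι] {p : ι → ℝ} {D B B' C : ℝ} (h0 : 0 < D)
    (h1 : D < 1) (hz : ∀ ξ : ℝ, riemannZeta (D + 2 * Real.pi * ξ * Complex.I) ≠ 0)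
    {g h : ℝ → ℝ} (hgm : Measurable g) (hhm : Measurable h)
    (hg : ∀ t, HasSum (fun j => Real.exp (-(D * p j)) * fractKernel D (t - p j)) (g t))
    (hh : ∀ t, HasSum (fun j => Real.exp (-(D * p j)) * stepKernel D (t - p j)) (h t))
    (hgB : ∀ t, g t ≤ B) (hhB : ∀ t, h t ≤ B') (hgC : Tendsto g atTop (𝓝 C)) :
    Tendsto h atTop (𝓝 (-C / (riemannZeta D).re)) := by
  -- ζ(D) is real, being -D times the integral of a real kernel.
  have hzr : (((riemannZeta D).re : ℝ) : ℂ) = riemannZeta D := by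
    rw [← Complex.conj_eq_iff_re]
    have hrep := (mellin_fract (s := D) (by simpa using h0) (by simpa using h1)).2
    have hD : (D : ℂ) ≠ 0 := by exact_mod_cast h0.ne'
    have hf := fourier_fractKernel h0 h1 0
    rw [Real.fourier_real_eq] at hf
    simp only [mul_zero, neg_zero, AddChar.map_zero_eq_one, one_smul, Complex.ofReal_zero,
      zero_mul, add_zero] at hf
    rw [integral_complex_ofReal, eq_div_iff hD] at hf
    have hf' : riemannZeta D = ((-((∫ v, fractKernel D v) * D) : ℝ) : ℂ) := by
      push_cast; rw [hf, neg_neg]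
    rw [hf', Complex.conj_ofReal]
  have hg0 : ∀ t, 0 ≤ g t := fun t =>
    (hg t).nonneg fun j => mul_nonneg (Real.exp_pos _).le (fractKernel_nonneg _ _)
  have hh0 : ∀ t, 0 ≤ h t := fun t =>
    (hh t).nonneg fun j => mul_nonneg (Real.exp_pos _).le (stepKernel_nonneg _ _)
  refine tendsto_of_tendsto_averages h0 hhm hh0 hhB ?_ ?_
  -- After multiplication by e^(Dt) the j-th term becomes the indicator of t ≥ p_j, hence monotone.
  · intro s t hst
    refine hasSum_le (fun j => ?_) ((hh s).mul_right _) ((hh t).mul_right _)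
    rw [mul_assoc, mul_assoc]
    refine mul_le_mul_of_nonneg_left ?_ (Real.exp_pos _).le
    by_cases hs : s - p j ∈ Ici (0 : ℝ)
    · have ht : t - p j ∈ Ici (0 : ℝ) := le_trans (mem_Ici.1 hs) (by linarith)
      rw [stepKernel, stepKernel, indicator_of_mem hs, indicator_of_mem ht, ← Real.exp_add,
        ← Real.exp_add]
      exact Real.exp_le_exp.2 (by ring_nf; rfl)
    · rw [stepKernel, indicator_of_notMem hs, zero_mul]
      exact mul_nonneg (stepKernel_nonneg _ _) (Real.exp_pos _).le
  · intro l hl hlc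
    -- Wiener's division: (-ζ/s)·m = (1/s)·l. Nonvanishing of ζ on the line keeps m smooth, so
    -- averages of h against l are averages of g against m.
    set m : ℝ → ℂ := fun ξ => -l ξ / riemannZeta (D + 2 * Real.pi * ξ * Complex.I) with hmdef
    have hms : ContDiff ℝ ∞ m := by
      simp only [hmdef, div_eq_mul_inv]
      exact hl.neg.mul ((contDiff_zeta_vertical h1).inv hz)
    have hmc : HasCompactSupport m := by
      have : m = fun ξ => l ξ * (-(riemannZeta (D + 2 * Real.pi * ξ * Complex.I))⁻¹) := by
        ext ξ; simp only [hmdef]; ring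
      rw [this]; exact hlc.mul_right
    have hli : Integrable l := hl.continuous.integrable_of_hasCompactSupport hlc
    have hmi : Integrable m := hms.continuous.integrable_of_hasCompactSupport hmc
    have hker : ∀ w, ∫ v, (fractKernel D v : ℂ) * 𝓕⁻ m (w - v) =
        ∫ v, (stepKernel D v : ℂ) * 𝓕⁻ l (w - v) := by
      intro w
      rw [integral_mul_fourierInv_sub (K := fun v => (fractKernel D v : ℂ))
          (integrable_fractKernel h0 h1).ofReal hmi,
        integral_mul_fourierInv_sub (K := fun v => (stepKernel D v : ℂ))
          (integrable_stepKernel h0).ofReal hli]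
      refine integral_congr_ae (ae_of_all _ fun ξ => ?_)
      simp only [fourier_fractKernel h0 h1, fourier_stepKernel h0, hmdef]
      have := hz ξ
      field_simp
    have hM := tendsto_integral_mul_of_tendsto hgm (B := B)
      (fun t => by rw [abs_of_nonneg (hg0 t)]; exact hgB t) hgC
      (integrable_fourierInv_of_smooth hms hmc)
    have hA : (C : ℂ) * ∫ v, 𝓕⁻ m v = ((-C / (riemannZeta D).re : ℝ) : ℂ) * l 0 := by
      rw [integral_fourierInv_of_smooth hms hmc]
      simp only [hmdef, Complex.ofReal_zero, mul_zero, zero_mul, add_zero]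
      push_cast
      rw [hzr]; ring
    rw [← hA]
    refine hM.congr fun u => ?_
    rw [integral_hasSum_translates (fun j => (Real.exp_pos _).le) (fractKernel_nonneg D)
      (measurable_fractKernel D) hg hgB (integrable_fourierInv_of_smooth hms hmc),
      integral_hasSum_translates (fun j => (Real.exp_pos _).le) (stepKernel_nonneg D)
      (measurable_stepKernel D) hh hhB (integrable_fourierInv_of_smooth hl hlc)]
    exact tsum_congr fun j => by rw [hker]

/-! ### Sums over a sequence of lengths -/

section Lengths

variable {ι : Type*} {ℓ : ι → ℝ}

/-- The sum of the fractional parts of `ℓ j * x`. -/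
noncomputable def fractSum (ℓ : ι → ℝ) (x : ℝ) : ℝ := ∑' j, Int.fract (ℓ j * x)

open Classical in
/-- The number of indices with `1 ≤ ℓ j * x`. -/
noncomputable def countSum (ℓ : ι → ℝ) (x : ℝ) : ℝ := ∑' j, if 1 ≤ ℓ j * x then (1 : ℝ) else 0

/-- The total length of the part within `δ / 2` of the endpoints of intervals of lengths `ℓ j`. -/
noncomputable def tubeSum (ℓ : ι → ℝ) (δ : ℝ) : ℝ := ∑' j, min (ℓ j) δ

theorem fract_le_self {x : ℝ} (hx : 0 ≤ x) : Int.fract x ≤ x := by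
  rw [Int.fract, sub_le_self_iff]; exact_mod_cast Int.floor_nonneg.2 hx

open Classical in
theorem ite_one_le {x : ℝ} (hx : 0 ≤ x) : (if 1 ≤ x then (1 : ℝ) else 0) ≤ x := by
  split_ifs with h
  · exact h
  · exact hx

theorem summable_fract (h0 : ∀ j, 0 < ℓ j) (hs : Summable ℓ)
    {x : ℝ} (hx : 0 ≤ x) : Summable fun j => Int.fract (ℓ j * x) :=
  Summable.of_nonneg_of_le (fun _ => Int.fract_nonneg _)
    (fun j => fract_le_self (mul_nonneg (h0 j).le hx)) (hs.mul_right x)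

open Classical in
theorem summable_count (h0 : ∀ j, 0 < ℓ j) (hs : Summable ℓ) {x : ℝ} (hx : 0 ≤ x) :
    Summable fun j => if 1 ≤ ℓ j * x then (1 : ℝ) else 0 :=
  Summable.of_nonneg_of_le (fun _ => by positivity)
    (fun j => ite_one_le (mul_nonneg (h0 j).le hx)) (hs.mul_right x)

theorem summable_tube (h0 : ∀ j, 0 < ℓ j) (hs : Summable ℓ)
    {δ : ℝ} (hδ : 0 ≤ δ) : Summable fun j => min (ℓ j) δ :=
  Summable.of_nonneg_of_le (fun j => le_min (h0 j).le hδ) (fun _ => min_le_left _ _) hs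

theorem countSum_nonneg (ℓ : ι → ℝ) (x : ℝ) : 0 ≤ countSum ℓ x := tsum_nonneg fun _ => by positivity

theorem fractSum_le (h0 : ∀ j, 0 < ℓ j) (hs : Summable ℓ)
    {x : ℝ} (hx : 0 ≤ x) : fractSum ℓ x ≤ (∑' j, ℓ j) * x := by
  rw [← tsum_mul_right]
  exact (summable_fract h0 hs hx).tsum_le_tsum
    (fun j => fract_le_self (mul_nonneg (h0 j).le hx)) (hs.mul_right x)

theorem countSum_le (h0 : ∀ j, 0 < ℓ j) (hs : Summable ℓ)
    {x : ℝ} (hx : 0 ≤ x) : countSum ℓ x ≤ (∑' j, ℓ j) * x := by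
  rw [← tsum_mul_right]
  exact (summable_count h0 hs hx).tsum_le_tsum
    (fun j => ite_one_le (mul_nonneg (h0 j).le hx)) (hs.mul_right x)

theorem countSum_mono (h0 : ∀ j, 0 < ℓ j) (hs : Summable ℓ)
    {x y : ℝ} (hx : 0 ≤ x) (hxy : x ≤ y) : countSum ℓ x ≤ countSum ℓ y := by
  classical
  refine (summable_count h0 hs hx).tsum_le_tsum (fun j => ?_) (summable_count h0 hs (hx.trans hxy))
  have := mul_le_mul_of_nonneg_left hxy (h0 j).le
  split_ifs <;> linarith

/-- An index counted at 2x but not at x has 1/2 ≤ ℓ_j x < 1, so its fractional part is ℓ_j x ≥ 1/2.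
-/
theorem countSum_two_mul_le (h0 : ∀ j, 0 < ℓ j) (hs : Summable ℓ) {x : ℝ} (hx : 0 ≤ x) :
    countSum ℓ (2 * x) ≤ countSum ℓ x + 2 * fractSum ℓ x := by
  classical
  have hsum := (summable_count h0 hs hx).add ((summable_fract h0 hs hx).mul_left 2)
  rw [countSum, countSum, fractSum, ← tsum_mul_left,
    ← (summable_count h0 hs hx).tsum_add ((summable_fract h0 hs hx).mul_left 2)]
  refine (summable_count h0 hs (by positivity)).tsum_le_tsum (fun j => ?_) hsum
  have hnn := mul_nonneg (h0 j).le hx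
  have hf := Int.fract_nonneg (ℓ j * x)
  split_ifs with h1 h2 h2
  · linarith
  · rw [Int.fract_eq_self.2 ⟨hnn, not_le.1 h2⟩]; linarith
  · linarith
  · linarith

/-- Large x is covered by the limit; for x < Y the linear bound suffices, since x ≤ Y x^D. -/
theorem fractSum_bound (h0 : ∀ j, 0 < ℓ j) (hs : Summable ℓ) {D C : ℝ} (hD : 0 < D) (hD1 : D < 1)
    (hC : Tendsto (fun x => fractSum ℓ x / x ^ D) atTop (𝓝 C)) :
    ∃ B, ∀ x > 0, fractSum ℓ x ≤ B * x ^ D := by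
  have hS : 0 ≤ ∑' j, ℓ j := tsum_nonneg fun j => (h0 j).le
  obtain ⟨X, hX⟩ := eventually_atTop.1 (hC.eventually (gt_mem_nhds (show C < C + 1 by linarith)))
  set Y := max X 1
  have hY : 1 ≤ Y := le_max_right _ _
  refine ⟨max (C + 1) ((∑' j, ℓ j) * Y), fun x hx => ?_⟩
  have hxD : 0 < x ^ D := Real.rpow_pos_of_pos hx D
  rcases le_or_gt Y x with h | h
  · have := hX x ((le_max_left _ _).trans h)
    rw [div_lt_iff₀ hxD] at this
    exact this.le.trans (mul_le_mul_of_nonneg_right (le_max_left _ _) hxD.le)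
  · refine (fractSum_le h0 hs hx.le).trans (le_trans ?_
      (mul_le_mul_of_nonneg_right (le_max_right _ _) hxD.le))
    rw [mul_assoc]
    refine mul_le_mul_of_nonneg_left ?_ hS
    rcases le_or_gt 1 x with h1 | h1
    · nlinarith [Real.one_le_rpow h1 hD.le]
    · have : x ≤ x ^ D := by
        simpa using Real.rpow_le_rpow_of_exponent_ge hx h1.le hD1.le
      nlinarith

theorem countSum_bound (h0 : ∀ j, 0 < ℓ j) (hs : Summable ℓ) {D B : ℝ} (hD : 0 < D) (hD1 : D < 1)
    (hB : ∀ x > 0, fractSum ℓ x ≤ B * x ^ D) : ∃ B', ∀ x > 0, countSum ℓ x ≤ B' * x ^ D := by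
  have h2D : 1 < (2 : ℝ) ^ D := Real.one_lt_rpow one_lt_two hD
  -- The second entry ensures B' + 2B ≤ 2^D B', which propagates the bound from x/2 to x; the first
  -- starts the induction on (0, 1].
  set B' := max (∑' j, ℓ j) (2 * B / ((2 : ℝ) ^ D - 1)) with hB'
  have hS : 0 ≤ ∑' j, ℓ j := tsum_nonneg fun j => (h0 j).le
  have hB'0 : 0 ≤ B' := hS.trans (le_max_left _ _)
  have key : ∀ n : ℕ, ∀ x > 0, x ≤ 2 ^ n → countSum ℓ x ≤ B' * x ^ D := by
    intro n
    induction n with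
    | zero =>
      intro x hx hx1
      rw [pow_zero] at hx1
      have : x ≤ x ^ D := by
        simpa using Real.rpow_le_rpow_of_exponent_ge hx hx1 hD1.le
      exact (countSum_le h0 hs hx.le).trans
        (mul_le_mul (le_max_left _ _) this hx.le hB'0)
    | succ n ih =>
      intro x hx hxn
      have hy : 0 < x / 2 := by positivity
      have h1 := countSum_two_mul_le h0 hs hy.le
      rw [mul_div_cancel₀ _ two_ne_zero] at h1
      have h2 := ih (x / 2) hy (by rw [pow_succ] at hxn; linarith)
      have h3 := hB (x / 2) hy
      have h4 : x ^ D = (2 : ℝ) ^ D * (x / 2) ^ D := by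
        rw [← Real.mul_rpow zero_le_two hy.le, mul_div_cancel₀ _ two_ne_zero]
      have h5 : 2 * B ≤ B' * ((2 : ℝ) ^ D - 1) := by
        rw [← div_le_iff₀ (by linarith)]; exact le_max_right _ _
      have h6 : 0 ≤ (x / 2) ^ D := Real.rpow_nonneg hy.le _
      rw [h4]
      nlinarith
  refine ⟨B', fun x hx => ?_⟩
  obtain ⟨n, hn⟩ := pow_unbounded_of_one_lt x one_lt_two
  exact key n x hx hn.le

theorem measurable_countSum_exp (h0 : ∀ j, 0 < ℓ j) (hs : Summable ℓ)
    : Measurable fun t => countSum ℓ (Real.exp t) := by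
  refine Monotone.measurable fun s t hst => countSum_mono h0 hs (Real.exp_pos _).le
    (Real.exp_le_exp.2 hst)

theorem measurable_fractSum_exp [Countable ι] : Measurable fun t => fractSum ℓ (Real.exp t) := by
  refine Measurable.tsum fun j => ?_
  exact measurable_fract.comp (Real.measurable_exp.const_mul _)

/-- If the sum of fractional parts is asymptotic to a power law and the zeta function has no zero on
the corresponding vertical line, then the counting function follows a power law. -/
theorem tendsto_countSum (h0 : ∀ j, 0 < ℓ j) (hs : Summable ℓ)
    [Countable ι] {D C : ℝ} (hD : 0 < D) (hD1 : D < 1)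
    (hz : ∀ ξ : ℝ, riemannZeta (D + 2 * Real.pi * ξ * Complex.I) ≠ 0)
    (hC : Tendsto (fun x => fractSum ℓ x / x ^ D) atTop (𝓝 C)) :
    Tendsto (fun x => countSum ℓ x / x ^ D) atTop (𝓝 (-C / (riemannZeta D).re)) := by
  classical
  obtain ⟨B, hB⟩ := fractSum_bound h0 hs hD hD1 hC
  obtain ⟨B', hB'⟩ := countSum_bound h0 hs hD hD1 hB
  have hexp : ∀ t : ℝ, Real.exp t ^ D = Real.exp (D * t) := fun t => by
    rw [← Real.exp_mul, mul_comm]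
  have hl : ∀ j t, Real.exp (t - -Real.log (ℓ j)) = ℓ j * Real.exp t := fun j t => by
    rw [sub_neg_eq_add, Real.exp_add, Real.exp_log (h0 j), mul_comm]
  have hw : ∀ j t, Real.exp (-(D * -Real.log (ℓ j))) *
      Real.exp (-(D * (t - -Real.log (ℓ j)))) = (Real.exp (D * t))⁻¹ := fun j t => by
    rw [← Real.exp_add, ← Real.exp_neg]; ring_nf
  -- With x = e^t and p_j = -log ℓ_j, the product ℓ_j x is e^(t - p_j) and the weight is ℓ_j^D.
  have key := tendsto_of_tendsto_fract (ι := ι) (p := fun j => -Real.log (ℓ j))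
    (g := fun t => fractSum ℓ (Real.exp t) / Real.exp (D * t))
    (h := fun t => countSum ℓ (Real.exp t) / Real.exp (D * t)) (B := B) (B' := B') (C := C)
    hD hD1 hz ((measurable_fractSum_exp).div (by fun_prop))
    ((measurable_countSum_exp h0 hs).div (by fun_prop)) ?_ ?_ ?_ ?_ ?_
  · have := key.comp Real.tendsto_log_atTop
    refine this.congr' ?_
    filter_upwards [eventually_gt_atTop 0] with x hx
    simp only [Function.comp, ← hexp, Real.exp_log hx]
  · intro t
    have := (summable_fract h0 hs (Real.exp_pos t).le).hasSum.mul_right (Real.exp (D * t))⁻¹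
    rw [div_eq_mul_inv]
    refine this.congr_fun fun j => ?_
    rw [fractKernel, hl, ← hw j t]; ring
  · intro t
    have := (summable_count h0 hs (Real.exp_pos t).le).hasSum.mul_right (Real.exp (D * t))⁻¹
    rw [div_eq_mul_inv]
    refine this.congr_fun fun j => ?_
    have hiff : 1 ≤ ℓ j * Real.exp t ↔ t - -Real.log (ℓ j) ∈ Ici (0 : ℝ) := by
      rw [← hl, mem_Ici, Real.one_le_exp_iff]
    rw [stepKernel]
    by_cases h : 1 ≤ ℓ j * Real.exp t
    · rw [if_pos h, indicator_of_mem (hiff.1 h), hw, one_mul]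
    · rw [if_neg h, indicator_of_notMem (fun h' => h (hiff.2 h')), mul_zero, zero_mul]
  · intro t
    rw [div_le_iff₀ (Real.exp_pos _), ← hexp]
    exact hB _ (Real.exp_pos t)
  · intro t
    rw [div_le_iff₀ (Real.exp_pos _), ← hexp]
    exact hB' _ (Real.exp_pos t)
  · refine (hC.comp Real.tendsto_exp_atTop).congr fun t => ?_
    simp only [Function.comp, hexp]

/-- min(ℓ_j, δ) is the integral over (0, δ] of the indicator of t ≤ ℓ_j, that is, of 1 ≤ ℓ_j t⁻¹;
then sum over j. -/
theorem tubeSum_eq_integral (h0 : ∀ j, 0 < ℓ j) (hs : Summable ℓ)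
    [Countable ι] {δ : ℝ} (hδ : 0 < δ) :
    IntervalIntegrable (fun t => countSum ℓ t⁻¹) volume 0 δ ∧
    tubeSum ℓ δ = ∫ t in (0 : ℝ)..δ, countSum ℓ t⁻¹ := by
  classical
  have hF : ∀ j, ∀ t ∈ Ioc (0 : ℝ) δ, (if 1 ≤ ℓ j * t⁻¹ then (1 : ℝ) else 0) =
      (Iic (ℓ j)).indicator 1 t := by
    intro j t ht
    have : 1 ≤ ℓ j * t⁻¹ ↔ t ∈ Iic (ℓ j) := by
      rw [← div_eq_mul_inv, one_le_div ht.1, mem_Iic]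
    by_cases h : 1 ≤ ℓ j * t⁻¹
    · rw [if_pos h, indicator_of_mem (this.1 h), Pi.one_apply]
    · rw [if_neg h, indicator_of_notMem (fun h' => h (this.2 h'))]
  have hint : ∀ j, Integrable ((Iic (ℓ j)).indicator (1 : ℝ → ℝ)) (volume.restrict (Ioc 0 δ)) :=
    fun j => (integrable_const (1 : ℝ)).indicator measurableSet_Iic
  have hval : ∀ j, ∫ t in Ioc 0 δ, (Iic (ℓ j)).indicator (1 : ℝ → ℝ) t = min (ℓ j) δ := by
    intro j
    rw [integral_indicator_one measurableSet_Iic, measureReal_restrict_apply measurableSet_Iic,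
      inter_comm, Ioc_inter_Iic, Real.volume_real_Ioc_of_le (le_inf hδ.le (h0 j).le), sub_zero,
      inf_comm]
  have hnorm : ∀ j, ∫ t in Ioc 0 δ, ‖(Iic (ℓ j)).indicator (1 : ℝ → ℝ) t‖ = min (ℓ j) δ := by
    intro j
    rw [← hval j]
    refine integral_congr_ae (ae_of_all _ fun t => ?_)
    exact Real.norm_of_nonneg (indicator_nonneg (fun _ _ => zero_le_one) _)
  have hsum : Summable fun j => ∫ t in Ioc 0 δ, ‖(Iic (ℓ j)).indicator (1 : ℝ → ℝ) t‖ := by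
    simp_rw [hnorm]; exact summable_tube h0 hs hδ.le
  have hcongr : ∀ t ∈ Ioc (0 : ℝ) δ, countSum ℓ t⁻¹ = ∑' j, (Iic (ℓ j)).indicator (1 : ℝ → ℝ) t :=
    fun t ht => tsum_congr fun j => hF j t ht
  have hmain := hasSum_integral_of_summable_integral_norm hint hsum
  constructor
  · rw [intervalIntegrable_iff_integrableOn_Ioc_of_le hδ.le]
    refine IntegrableOn.congr_fun ?_ (fun t ht => (hcongr t ht).symm) measurableSet_Ioc
    refine ⟨(Measurable.tsum fun j =>
      measurable_one.indicator measurableSet_Iic).aestronglyMeasurable, ?_⟩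
    refine lt_of_le_of_lt (b := ∑' j, ENNReal.ofReal (min (ℓ j) δ)) ?_ ?_
    · calc _ ≤ ∫⁻ t in Ioc 0 δ, ∑' j, ‖(Iic (ℓ j)).indicator (1 : ℝ → ℝ) t‖ₑ :=
            lintegral_mono fun t => enorm_tsum_le_tsum_enorm
        _ = ∑' j, ∫⁻ t in Ioc 0 δ, ‖(Iic (ℓ j)).indicator (1 : ℝ → ℝ) t‖ₑ :=
            lintegral_tsum fun j =>
              (measurable_one.indicator measurableSet_Iic).enorm.aemeasurable
        _ = _ := tsum_congr fun j => by
            rw [← hnorm j, ofReal_integral_norm_eq_lintegral_enorm (hint j)]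
    · rw [← ENNReal.ofReal_tsum_of_nonneg (fun j => le_min (h0 j).le hδ.le)
        (summable_tube h0 hs hδ.le)]
      exact ENNReal.ofReal_lt_top
  · rw [intervalIntegral.integral_of_le hδ.le, setIntegral_congr_fun measurableSet_Ioc hcongr,
      ← hmain.tsum_eq, tubeSum]
    exact tsum_congr fun j => (hval j).symm

theorem integral_inv_rpow {D δ : ℝ} (hD1 : D < 1) (hδ : 0 < δ) :
    IntervalIntegrable (fun t : ℝ => t⁻¹ ^ D) volume 0 δ ∧
    ∫ t in (0 : ℝ)..δ, t⁻¹ ^ D = δ ^ (1 - D) / (1 - D) := by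
  have e : EqOn (fun t : ℝ => t ^ (-D)) (fun t : ℝ => t⁻¹ ^ D) (uIoc 0 δ) := by
    intro t ht
    rw [uIoc_of_le hδ.le] at ht
    simp only
    rw [Real.inv_rpow ht.1.le, Real.rpow_neg ht.1.le]
  refine ⟨(intervalIntegral.intervalIntegrable_rpow' (by linarith)).congr e, ?_⟩
  rw [← intervalIntegral.integral_congr_ae (ae_of_all _ e), integral_rpow (Or.inl (by linarith)),
    show -D + 1 = 1 - D by ring, Real.zero_rpow (by linarith), sub_zero]

theorem tendsto_tubeSum (h0 : ∀ j, 0 < ℓ j) (hs : Summable ℓ) [Countable ι] {D A : ℝ} (hD1 : D < 1)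
    (hA : Tendsto (fun x => countSum ℓ x / x ^ D) atTop (𝓝 A)) :
    Tendsto (fun δ => tubeSum ℓ δ / δ ^ (1 - D)) (𝓝[>] 0) (𝓝 (A / (1 - D))) := by
  have h1D : 0 < 1 - D := by linarith
  rw [Metric.tendsto_nhds]
  intro ε hε
  -- Integrating t^(-D) divides by 1 - D; this tolerance leaves ε/2 afterwards.
  have hη : 0 < ε * (1 - D) / 2 := by positivity
  obtain ⟨X, hX⟩ := eventually_atTop.1 (Metric.tendsto_nhds.1 hA _ hη)
  set Y := max X 1
  have hY : 0 < Y := lt_of_lt_of_le one_pos (le_max_right _ _)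
  filter_upwards [Ioo_mem_nhdsGT (inv_pos.2 hY)] with δ hδ
  obtain ⟨hi, he⟩ := tubeSum_eq_integral h0 hs hδ.1
  obtain ⟨hi', he'⟩ := integral_inv_rpow hD1 hδ.1
  have hpt : ∀ t ∈ Ioc 0 δ, |countSum ℓ t⁻¹ - A * t⁻¹ ^ D| ≤ ε * (1 - D) / 2 * t⁻¹ ^ D := by
    intro t ht
    have h1 : Y ≤ t⁻¹ := by
      rw [le_inv_comm₀ hY ht.1]; exact ht.2.trans hδ.2.le
    have h2 := hX t⁻¹ ((le_max_left _ _).trans h1)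
    have h3 : 0 < t⁻¹ ^ D := Real.rpow_pos_of_pos (inv_pos.2 ht.1) D
    rw [Real.dist_eq] at h2
    have : countSum ℓ t⁻¹ - A * t⁻¹ ^ D = (countSum ℓ t⁻¹ / t⁻¹ ^ D - A) * t⁻¹ ^ D := by
      rw [sub_mul, div_mul_cancel₀ _ h3.ne']
    rw [this, abs_mul, abs_of_pos h3]
    exact mul_le_mul_of_nonneg_right h2.le h3.le
  have hb : |tubeSum ℓ δ - A * (δ ^ (1 - D) / (1 - D))| ≤
      ε * (1 - D) / 2 * (δ ^ (1 - D) / (1 - D)) := by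
    rw [he, ← he', ← intervalIntegral.integral_const_mul, ← intervalIntegral.integral_const_mul,
      ← intervalIntegral.integral_sub hi (hi'.const_mul _)]
    have := intervalIntegral.norm_integral_le_of_norm_le hδ.1.le
      (f := fun t => countSum ℓ t⁻¹ - A * t⁻¹ ^ D) (ae_of_all _ fun t ht => hpt t ht)
      (hi'.const_mul _)
    exact this
  have hpos : 0 < δ ^ (1 - D) := Real.rpow_pos_of_pos hδ.1 _
  rw [Real.dist_eq]
  have e : tubeSum ℓ δ / δ ^ (1 - D) - A / (1 - D) =
      (tubeSum ℓ δ - A * (δ ^ (1 - D) / (1 - D))) / δ ^ (1 - D) := by field_simp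
  rw [e, abs_div, abs_of_pos hpos, div_lt_iff₀ hpos]
  refine lt_of_le_of_lt hb ?_
  have : ε * (1 - D) / 2 * (δ ^ (1 - D) / (1 - D)) = ε / 2 * δ ^ (1 - D) := by field_simp
  rw [this]
  exact mul_lt_mul_of_pos_right (by linarith) hpos

end Lengths

/-! ### Tube volume and spectral count of a string in terms of its lengths -/

namespace FractalString

/-- The lengths of the intervals of a string. -/
noncomputable def lengths (Ω : Set ℝ) (I : intervals Ω) : ℝ := volume.real I.1

theorem intervals_pairwiseDisjoint (Ω : Set ℝ) : (intervals Ω).PairwiseDisjoint id := by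
  rintro I ⟨x, hx, rfl⟩ J ⟨y, hy, rfl⟩ hne
  refine Set.disjoint_left.2 fun z hz hz' => hne ?_
  rw [connectedComponentIn_eq hz, connectedComponentIn_eq hz']

theorem iUnion_intervals (Ω : Set ℝ) : ⋃ I : intervals Ω, I.1 = Ω := by
  ext x
  simp only [mem_iUnion]
  constructor
  · rintro ⟨⟨I, y, hy, rfl⟩, hx⟩
    exact connectedComponentIn_subset _ _ hx
  · exact fun hx => ⟨⟨_, x, hx, rfl⟩, mem_connectedComponentIn hx⟩

theorem isOpen_of_mem_intervals {Ω I : Set ℝ} (hΩ : IsOpen Ω) (hI : I ∈ intervals Ω) : IsOpen I := by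
  obtain ⟨x, hx, rfl⟩ := hI
  exact hΩ.connectedComponentIn

theorem nonempty_of_mem_intervals {Ω I : Set ℝ} (hI : I ∈ intervals Ω) : I.Nonempty := by
  obtain ⟨x, hx, rfl⟩ := hI
  exact ⟨x, mem_connectedComponentIn hx⟩

theorem subset_of_mem_intervals {Ω I : Set ℝ} (hI : I ∈ intervals Ω) : I ⊆ Ω := by
  obtain ⟨x, hx, rfl⟩ := hI
  exact connectedComponentIn_subset _ _

theorem eq_of_mem_intervals_of_mem {Ω I : Set ℝ} (hI : I ∈ intervals Ω) {x : ℝ} (hx : x ∈ I) :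
    I = connectedComponentIn Ω x := by
  obtain ⟨y, hy, rfl⟩ := hI
  exact connectedComponentIn_eq hx

theorem countable_intervals {Ω : Set ℝ} (hΩ : IsOpen Ω) : (intervals Ω).Countable :=
  (intervals_pairwiseDisjoint Ω).countable_of_isOpen (fun _ hI => isOpen_of_mem_intervals hΩ hI)
    (fun _ hI => nonempty_of_mem_intervals hI)

theorem exists_eq_Ioo_of_isPreconnected {I : Set ℝ} (ho : IsOpen I) (hc : IsPreconnected I)
    (hb : Bornology.IsBounded I) (hne : I.Nonempty) : ∃ a b, a < b ∧ I = Ioo a b := by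
  have hI : I = Ioo (sInf I) (sSup I) := by
    refine Subset.antisymm ?_ (IsConnected.Ioo_csInf_csSup_subset ⟨hne, hc⟩ hb.bddBelow hb.bddAbove)
    rw [← interior_Icc]
    exact interior_maximal (subset_Icc_csInf_csSup hb.bddBelow hb.bddAbove) ho
  refine ⟨sInf I, sSup I, ?_, hI⟩
  rw [hI] at hne
  exact nonempty_Ioo.1 hne

/-- An interval of a bounded open set is an open interval whose endpoints are boundary points. -/
theorem exists_eq_Ioo {Ω I : Set ℝ} (hΩ : IsOpen Ω) (hb : Bornology.IsBounded Ω)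
    (hI : I ∈ intervals Ω) :
    ∃ a b, a < b ∧ I = Ioo a b ∧ a ∈ frontier Ω ∧ b ∈ frontier Ω := by
  obtain ⟨a, b, hab, rfl⟩ := exists_eq_Ioo_of_isPreconnected (isOpen_of_mem_intervals hΩ hI)
    (by obtain ⟨x, hx, rfl⟩ := hI; exact isPreconnected_connectedComponentIn)
    (hb.subset (subset_of_mem_intervals hI)) (nonempty_of_mem_intervals hI)
  have hcl : Icc a b ⊆ closure Ω := by
    rw [← closure_Ioo hab.ne]; exact closure_mono (subset_of_mem_intervals hI)
  -- If c were in Ω, its open component would meet the interval, hence coincide with it and put c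
  -- inside.
  have hnot : ∀ c ∈ Icc a b, c ∉ Ioo a b → c ∈ frontier Ω := by
    intro c hc hcI
    rw [hΩ.frontier_eq]
    refine ⟨hcl hc, fun hcΩ => hcI ?_⟩
    have hJ : IsOpen (connectedComponentIn Ω c) := hΩ.connectedComponentIn
    have hc' : c ∈ closure (Ioo a b) := by rwa [closure_Ioo hab.ne]
    obtain ⟨z, hz, hzI⟩ := mem_closure_iff.1 hc' _ hJ (mem_connectedComponentIn hcΩ)
    rw [eq_of_mem_intervals_of_mem hI hzI, ← connectedComponentIn_eq hz]
    exact mem_connectedComponentIn hcΩ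
  exact ⟨a, b, hab, rfl, hnot a ⟨le_rfl, hab.le⟩ (by simp), hnot b ⟨hab.le, le_rfl⟩ (by simp)⟩

/-- No boundary point lies inside an interval of Ω, so the distance to the boundary is the distance
to the nearer endpoint. -/
theorem innerTube_inter_Ioo {Ω : Set ℝ} (hΩ : IsOpen Ω) {a b : ℝ} (hI : Ioo a b ⊆ Ω)
    (ha : a ∈ frontier Ω) (hb : b ∈ frontier Ω) (ε : ℝ) :
    innerTube Ω ε ∩ Ioo a b = Ioo a b \ Icc (a + ε) (b - ε) := by
  ext x
  constructor
  · rintro ⟨⟨hxΩ, hx⟩, hxI⟩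
    refine ⟨hxI, fun hxc => ?_⟩
    obtain ⟨y, hy, hd⟩ := (Metric.infDist_lt_iff ⟨a, ha⟩).1 hx
    rw [hΩ.frontier_eq] at hy
    have hyI : y ∉ Ioo a b := fun h => hy.2 (hI h)
    rw [Real.dist_eq, abs_lt] at hd
    rcases le_or_gt y a with h | h
    · linarith [hxc.1]
    · have : b ≤ y := by
        by_contra hc
        exact hyI ⟨h, not_le.1 hc⟩
      linarith [hxc.2]
  · rintro ⟨hxI, hx⟩
    refine ⟨⟨hI hxI, (Metric.infDist_lt_iff ⟨a, ha⟩).2 ?_⟩, hxI⟩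
    rw [mem_Icc, not_and_or, not_le, not_le] at hx
    rcases hx with h | h
    · exact ⟨a, ha, by rw [Real.dist_eq, abs_of_pos (by linarith [hxI.1])]; linarith⟩
    · exact ⟨b, hb, by rw [Real.dist_eq, abs_of_neg (by linarith [hxI.2])]; linarith⟩

theorem volume_Ioo_diff_Icc {a b ε : ℝ} (hε : 0 < ε) :
    volume (Ioo a b \ Icc (a + ε) (b - ε)) = ENNReal.ofReal (min (b - a) (2 * ε)) := by
  have hsub : Icc (a + ε) (b - ε) ⊆ Ioo a b :=
    fun x hx => ⟨by linarith [hx.1], by linarith [hx.2]⟩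
  rw [measure_sdiff hsub
    measurableSet_Icc.nullMeasurableSet (by simp), Real.volume_Ioo, Real.volume_Icc]
  rcases le_total (b - a) (2 * ε) with h | h
  · rw [min_eq_left h, ENNReal.ofReal_of_nonpos (p := b - ε - (a + ε)) (by linarith), tsub_zero]
  · rw [min_eq_right h, ← ENNReal.ofReal_sub _ (by linarith)]
    ring_nf

theorem lengths_pos {Ω : Set ℝ} (hΩ : IsOpen Ω) (hb : Bornology.IsBounded Ω) (I : intervals Ω) :
    0 < lengths Ω I := by
  obtain ⟨a, b, hab, hI, -⟩ := exists_eq_Ioo hΩ hb I.2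
  rw [lengths, hI, Real.volume_real_Ioo_of_le hab.le]
  linarith

theorem volume_eq_tsum {Ω : Set ℝ} (hΩ : IsOpen Ω) {s : Set ℝ} (hs : ∀ I ∈ intervals Ω,
    MeasurableSet (s ∩ I)) (hsub : s ⊆ Ω) : volume s = ∑' I : intervals Ω, volume (s ∩ I.1) := by
  have : Countable (intervals Ω) := (countable_intervals hΩ).to_subtype
  rw [← measure_iUnion (f := fun I : intervals Ω => s ∩ I.1) ?_ fun I => hs I.1 I.2]
  · rw [← inter_iUnion, iUnion_intervals, inter_eq_left.2 hsub]
  · intro I J hIJ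
    exact ((intervals_pairwiseDisjoint Ω) I.2 J.2 fun h => hIJ (Subtype.ext h)).mono
      inter_subset_right inter_subset_right

theorem hasSum_lengths {Ω : Set ℝ} (hΩ : IsOpen Ω) (hb : Bornology.IsBounded Ω) :
    HasSum (lengths Ω) (volume.real Ω) := by
  have h := volume_eq_tsum hΩ (s := Ω) (fun I hI => hΩ.measurableSet.inter
    (isOpen_of_mem_intervals hΩ hI).measurableSet) Subset.rfl
  have e : ∀ I : intervals Ω, volume (Ω ∩ I.1) = volume I.1 := fun I => by
    rw [inter_eq_right.2 (subset_of_mem_intervals I.2)]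
  simp_rw [e] at h
  have hne : ∑' I : intervals Ω, volume I.1 ≠ ⊤ := h ▸ hb.measure_lt_top.ne
  rw [measureReal_def, h, ENNReal.tsum_toReal_eq fun I => ENNReal.ne_top_of_tsum_ne_top hne I]
  exact ENNReal.hasSum_toReal hne

theorem summable_lengths {Ω : Set ℝ} (hΩ : IsOpen Ω) (hb : Bornology.IsBounded Ω) :
    Summable (lengths Ω) := (hasSum_lengths hΩ hb).summable

theorem volume_innerTube {Ω : Set ℝ} (hΩ : IsOpen Ω) (hb : Bornology.IsBounded Ω) {ε : ℝ}
    (hε : 0 < ε) : volume (innerTube Ω ε) = ENNReal.ofReal (tubeSum (lengths Ω) (2 * ε)) := by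
  have hI : ∀ I ∈ intervals Ω, MeasurableSet (innerTube Ω ε ∩ I) ∧
      volume (innerTube Ω ε ∩ I) = ENNReal.ofReal (min (volume.real I) (2 * ε)) := by
    intro I hI
    obtain ⟨a, b, hab, rfl, ha, hb'⟩ := exists_eq_Ioo hΩ hb hI
    rw [innerTube_inter_Ioo hΩ (subset_of_mem_intervals hI) ha hb', volume_Ioo_diff_Icc hε,
      Real.volume_real_Ioo_of_le hab.le]
    exact ⟨measurableSet_Ioo.diff measurableSet_Icc, rfl⟩
  rw [volume_eq_tsum hΩ (fun I h => (hI I h).1) (fun x hx => hx.1), tubeSum,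
    ENNReal.ofReal_tsum_of_nonneg
    (fun I => le_min (lengths_pos hΩ hb I).le (by positivity))
    (summable_tube (lengths_pos hΩ hb) (summable_lengths hΩ hb) (by positivity))]
  exact tsum_congr fun I => (hI I.1 I.2).2

theorem spectralCount_eq {Ω : Set ℝ} (hΩ : IsOpen Ω) (hb : Bornology.IsBounded Ω) {x : ℝ}
    (hx : 0 ≤ x) : weylTerm Ω x - (spectralCount Ω x : ℝ) = fractSum (lengths Ω) x := by
  have hpos := lengths_pos hΩ hb
  have hsum := summable_lengths hΩ hb
  -- Only finitely many intervals carry a frequency up to x, so the `ncard` is a genuine count and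
  -- not the default 0.
  have hfin : {I : intervals Ω | 1 ≤ lengths Ω I * x}.Finite := by
    have := hsum.tendsto_cofinite_zero.eventually (gt_mem_nhds (show (0 : ℝ) < (x + 1)⁻¹ by positivity))
    rw [eventually_cofinite] at this
    refine this.subset fun I hI hlt => ?_
    have h1 : lengths Ω I * (x + 1) < 1 := by
      rwa [← lt_div_iff₀ (by positivity), one_div]
    have h2 : 1 ≤ lengths Ω I * x := hI
    have := hpos I
    nlinarith
  have hset : {p : Set ℝ × ℕ | p.1 ∈ intervals Ω ∧ 1 ≤ p.2 ∧
      (p.2 : ℝ) * (volume.real p.1)⁻¹ ≤ x} =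
      (fun q : (_ : intervals Ω) × ℕ => (q.1.1, q.2)) ''
        (hfin.toFinset.sigma fun I => Finset.Icc 1 ⌊lengths Ω I * x⌋₊ : Finset _) := by
    ext ⟨I, n⟩
    simp only [mem_ofPred_eq, mem_image, Finset.mem_coe, Finset.mem_sigma, Finite.mem_toFinset,
      Finset.mem_Icc]
    constructor
    · rintro ⟨hI, hn, hle⟩
      have hl : 0 < lengths Ω ⟨I, hI⟩ := hpos ⟨I, hI⟩
      have h1 : (n : ℝ) ≤ lengths Ω ⟨I, hI⟩ * x := by
        rw [← div_eq_mul_inv] at hle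
        rw [mul_comm]; exact (div_le_iff₀ hl).1 hle
      have hn' : (1 : ℝ) ≤ n := by exact_mod_cast hn
      exact ⟨⟨⟨I, hI⟩, n⟩, ⟨hn'.trans h1, hn, Nat.le_floor h1⟩, rfl⟩
    · rintro ⟨⟨⟨J, hJ⟩, m⟩, ⟨-, hm, hle⟩, heq⟩
      simp only [Prod.mk.injEq] at heq
      obtain ⟨rfl, rfl⟩ := heq
      have hl : 0 < lengths Ω ⟨J, hJ⟩ := hpos ⟨J, hJ⟩
      refine ⟨hJ, hm, ?_⟩
      rw [← div_eq_mul_inv]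
      refine (div_le_iff₀ hl).2 ?_
      rw [mul_comm]
      exact (Nat.le_floor_iff (by positivity)).1 hle
  have hcard : (spectralCount Ω x : ℝ) = ∑' I, ((⌊lengths Ω I * x⌋₊ : ℕ) : ℝ) := by
    rw [spectralCount, hset, ncard_image_of_injective, ncard_coe_finset, Finset.card_sigma,
      tsum_eq_sum (s := hfin.toFinset)]
    · simp
    · intro I hI
      rw [Finite.mem_toFinset, mem_ofPred_eq, not_le] at hI
      rw [Nat.floor_eq_zero.2 hI, Nat.cast_zero]
    · rintro ⟨I, n⟩ ⟨J, m⟩ h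
      simp only [Prod.mk.injEq] at h
      obtain ⟨h1, rfl⟩ := h
      rw [Subtype.ext h1]
  have hfr : ∀ I, ((⌊lengths Ω I * x⌋₊ : ℕ) : ℝ) = lengths Ω I * x - Int.fract (lengths Ω I * x) := by
    intro I
    rw [natCast_floor_eq_intCast_floor (mul_nonneg (hpos I).le hx), Int.self_sub_fract]
  simp_rw [hfr] at hcard
  rw [hcard, (hsum.mul_right x).tsum_sub (summable_fract hpos hsum hx), tsum_mul_right,
    (hasSum_lengths hΩ hb).tsum_eq, weylTerm, fractSum]
  ring

end FractalString

/-! ### Nonvanishing of zeta on the line implies (ISP)_D -/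

namespace FractalString

theorem tubeRatio_eq {Ω : Set ℝ} (hΩ : IsOpen Ω) (hb : Bornology.IsBounded Ω) (d : ℝ) {ε : ℝ}
    (hε : 0 < ε) :
    tubeRatio Ω d ε = ENNReal.ofReal (tubeSum (lengths Ω) (2 * ε) / ε ^ (1 - d)) := by
  rw [tubeRatio, volume_innerTube hΩ hb hε, ENNReal.ofReal_div_of_pos (Real.rpow_pos_of_pos hε _)]

theorem tendsto_two_mul_nhdsGT_zero : Tendsto (fun ε : ℝ => 2 * ε) (𝓝[>] 0) (𝓝[>] 0) := by
  refine tendsto_nhdsWithin_of_tendsto_nhds_of_eventually_within _ ?_ ?_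
  · have : Continuous fun ε : ℝ => 2 * ε := by fun_prop
    simpa using (this.tendsto 0).mono_left nhdsWithin_le_nhds
  · filter_upwards [self_mem_nhdsWithin] with ε hε
    have : (0 : ℝ) < ε := hε
    exact mul_pos two_pos this

theorem tendsto_tubeRatio {Ω : Set ℝ} (hΩ : IsOpen Ω) (hb : Bornology.IsBounded Ω) {D T : ℝ}
    (hT : Tendsto (fun δ => tubeSum (lengths Ω) δ / δ ^ (1 - D)) (𝓝[>] 0) (𝓝 T)) :
    Tendsto (tubeRatio Ω D) (𝓝[>] 0) (𝓝 (ENNReal.ofReal (2 ^ (1 - D) * T))) := by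
  have h1 := ENNReal.tendsto_ofReal ((hT.comp tendsto_two_mul_nhdsGT_zero).const_mul
    ((2 : ℝ) ^ (1 - D)))
  refine h1.congr' ?_
  filter_upwards [self_mem_nhdsWithin] with ε hε
  have hε : (0 : ℝ) < ε := hε
  rw [tubeRatio_eq hΩ hb D hε]
  congr 1
  simp only [Function.comp]
  rw [Real.mul_rpow zero_le_two hε.le]
  have h2 : (2 : ℝ) ^ (1 - D) ≠ 0 := (Real.rpow_pos_of_pos two_pos _).ne'
  have h3 : ε ^ (1 - D) ≠ 0 := (Real.rpow_pos_of_pos hε _).ne'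
  field_simp

/-- The second-order spectral asymptotics in terms of fractional parts. -/
theorem spectral_asymptotics_iff {Ω : Set ℝ} (hΩ : IsOpen Ω) (hb : Bornology.IsBounded Ω)
    (D C : ℝ) :
    ((fun x : ℝ => (spectralCount Ω x : ℝ) - (weylTerm Ω x - C * x ^ D))
        =o[atTop] (fun x : ℝ => x ^ D)) ↔
      Tendsto (fun x => fractSum (lengths Ω) x / x ^ D) atTop (𝓝 C) := by
  rw [Asymptotics.isLittleO_iff_tendsto' (by
    filter_upwards [eventually_gt_atTop 0] with x hx h
    exact absurd h (Real.rpow_pos_of_pos hx D).ne')]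
  have e : (fun x : ℝ => ((spectralCount Ω x : ℝ) - (weylTerm Ω x - C * x ^ D)) / x ^ D) =ᶠ[atTop]
      fun x => C - fractSum (lengths Ω) x / x ^ D := by
    filter_upwards [eventually_gt_atTop 0] with x hx
    rw [← spectralCount_eq hΩ hb hx.le]
    have := (Real.rpow_pos_of_pos hx D).ne'
    field_simp
    ring
  rw [tendsto_congr' e]
  constructor
  · intro h
    simpa using h.const_sub C
  · intro h
    simpa using h.const_sub C

/-- If the zeta function does not vanish on the vertical line through `D`, then the inverse spectral
problem in dimension `D` has an affirmative answer. -/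
theorem isp_of_riemannZeta_ne_zero {D : ℝ} (h0 : 0 < D) (h1 : D < 1)
    (hz : ∀ ξ : ℝ, riemannZeta (D + 2 * Real.pi * ξ * Complex.I) ≠ 0) : ISP D := by
  rintro Ω ⟨hΩ, hb, -⟩ hdim ⟨C, hC, hasymp⟩
  have : Countable (intervals Ω) := (countable_intervals hΩ).to_subtype
  rw [spectral_asymptotics_iff hΩ hb] at hasymp
  have hcount := tendsto_countSum (lengths_pos hΩ hb) (summable_lengths hΩ hb) h0 h1 hz hasymp
  have htube := tendsto_tubeRatio hΩ hb
    (tendsto_tubeSum (lengths_pos hΩ hb) (summable_lengths hΩ hb) h1 hcount)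
  -- The limit is nonnegative as a limit of counts, and nonzero since C is nonzero; no sign
  -- condition on C has to be imposed.
  have hA0 : 0 ≤ -C / (riemannZeta D).re := ge_of_tendsto hcount (by
    filter_upwards [eventually_gt_atTop 0] with x hx
    exact div_nonneg (countSum_nonneg _ _) (Real.rpow_pos_of_pos hx D).le)
  have hA : 0 < -C / (riemannZeta D).re := lt_of_le_of_ne hA0 (Ne.symm
    (div_ne_zero (neg_ne_zero.2 hC) (riemannZeta_re_neg_of_mem_Ioo h0 h1).ne))
  rw [IsMinkowskiMeasurable, hdim, upperContent, lowerContent, htube.limsup_eq, htube.liminf_eq]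
  refine ⟨ENNReal.ofReal_pos.2 ?_, rfl, ENNReal.ofReal_lt_top⟩
  have h1D : 0 < 1 - D := by linarith
  positivity

end FractalString

/-! ### Realizing prescribed lengths; dimension and measurability criteria -/

namespace FractalString

/-- The endpoints of consecutive intervals of lengths `ℓ n`. -/
noncomputable def endpoint (ℓ : ℕ → ℝ) (n : ℕ) : ℝ := ∑ i ∈ Finset.range n, ℓ i

theorem strictMono_endpoint {ℓ : ℕ → ℝ} (h0 : ∀ n, 0 < ℓ n) : StrictMono (endpoint ℓ) :=
  strictMono_nat_of_lt_succ fun n => by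
    rw [endpoint, endpoint, Finset.sum_range_succ]; linarith [h0 n]

/-- The union of consecutive open intervals of lengths `ℓ n`. -/
def ofLengths (ℓ : ℕ → ℝ) : Set ℝ := ⋃ n, Ioo (endpoint ℓ n) (endpoint ℓ (n + 1))

theorem endpoint_notMem {ℓ : ℕ → ℝ} (h0 : ∀ n, 0 < ℓ n) (m : ℕ) : endpoint ℓ m ∉ ofLengths ℓ := by
  intro h
  obtain ⟨k, hk⟩ := mem_iUnion.1 h
  have h1 := (strictMono_endpoint h0).lt_iff_lt.1 hk.1
  have h2 := (strictMono_endpoint h0).lt_iff_lt.1 hk.2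
  omega

/-- A component is order-connected, so it cannot pass the endpoints, which lie outside the set. -/
theorem connectedComponentIn_ofLengths {ℓ : ℕ → ℝ} (h0 : ∀ n, 0 < ℓ n) {n : ℕ} {x : ℝ}
    (hx : x ∈ Ioo (endpoint ℓ n) (endpoint ℓ (n + 1))) :
    connectedComponentIn (ofLengths ℓ) x = Ioo (endpoint ℓ n) (endpoint ℓ (n + 1)) := by
  have hsub : Ioo (endpoint ℓ n) (endpoint ℓ (n + 1)) ⊆ ofLengths ℓ :=
    subset_iUnion (fun n => Ioo (endpoint ℓ n) (endpoint ℓ (n + 1))) n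
  refine Subset.antisymm (fun y hy => ?_) (isPreconnected_Ioo.subset_connectedComponentIn hx hsub)
  have hord : OrdConnected (connectedComponentIn (ofLengths ℓ) x) :=
    isPreconnected_connectedComponentIn.ordConnected
  have hxc := mem_connectedComponentIn (hsub hx)
  constructor
  · by_contra! h
    exact endpoint_notMem h0 n (connectedComponentIn_subset _ _ (hord.out hy hxc ⟨h, hx.1.le⟩))
  · by_contra! h
    exact endpoint_notMem h0 (n + 1)
      (connectedComponentIn_subset _ _ (hord.out hxc hy ⟨hx.2.le, h⟩))

theorem intervals_ofLengths {ℓ : ℕ → ℝ} (h0 : ∀ n, 0 < ℓ n) :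
    intervals (ofLengths ℓ) = range fun n => Ioo (endpoint ℓ n) (endpoint ℓ (n + 1)) := by
  ext I
  constructor
  · rintro ⟨x, hx, rfl⟩
    obtain ⟨n, hn⟩ := mem_iUnion.1 hx
    exact ⟨n, (connectedComponentIn_ofLengths h0 hn).symm⟩
  · rintro ⟨n, rfl⟩
    obtain ⟨x, hx⟩ := nonempty_Ioo.2 (strictMono_endpoint h0 n.lt_succ_self)
    exact ⟨x, mem_iUnion.2 ⟨n, hx⟩, (connectedComponentIn_ofLengths h0 hx).symm⟩

theorem injective_Ioo_endpoint {ℓ : ℕ → ℝ} (h0 : ∀ n, 0 < ℓ n) :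
    Function.Injective fun n => Ioo (endpoint ℓ n) (endpoint ℓ (n + 1)) := by
  intro m n h
  have hlt := fun k : ℕ => strictMono_endpoint h0 k.lt_succ_self
  have h' := congrArg sInf h
  simp only at h'
  rw [csInf_Ioo (hlt m), csInf_Ioo (hlt n)] at h'
  exact (strictMono_endpoint h0).injective h'

/-- Every summable sequence of positive lengths is realized by a fractal string. -/
theorem exists_fractalString {ℓ : ℕ → ℝ} (h0 : ∀ n, 0 < ℓ n) (hs : Summable ℓ) :
    ∃ Ω, IsFractalString Ω ∧ ∃ e : ℕ ≃ intervals Ω, ∀ n, lengths Ω (e n) = ℓ n := by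
  have hint := intervals_ofLengths h0
  refine ⟨ofLengths ℓ, ⟨isOpen_iUnion fun n => isOpen_Ioo, ?_, ?_⟩, ?_⟩
  · refine (Metric.isBounded_Icc 0 (∑' n, ℓ n)).subset (iUnion_subset fun n x hx => ?_)
    exact ⟨(Finset.sum_nonneg fun i _ => (h0 i).le).trans hx.1.le,
      hx.2.le.trans (hs.sum_le_tsum _ fun i _ => (h0 i).le)⟩
  · rw [hint]; exact infinite_range_of_injective (injective_Ioo_endpoint h0)
  · refine ⟨(Equiv.ofInjective _ (injective_Ioo_endpoint h0)).trans (Equiv.setCongr hint.symm),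
      fun n => ?_⟩
    have : lengths (ofLengths ℓ) (((Equiv.ofInjective _ (injective_Ioo_endpoint h0)).trans
      (Equiv.setCongr hint.symm)) n) =
        volume.real (Ioo (endpoint ℓ n) (endpoint ℓ (n + 1))) := rfl
    rw [this, Real.volume_real_Ioo_of_le (strictMono_endpoint h0 n.lt_succ_self).le, endpoint,
      endpoint, Finset.sum_range_succ]
    ring

theorem fractSum_comp_equiv {ι κ : Type*} {ℓ : ι → ℝ} {m : κ → ℝ} (e : κ ≃ ι)
    (h : ∀ n, ℓ (e n) = m n) : fractSum ℓ = fractSum m := by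
  funext x
  rw [fractSum, fractSum, ← e.tsum_eq]
  simp_rw [h]

theorem tubeSum_comp_equiv {ι κ : Type*} {ℓ : ι → ℝ} {m : κ → ℝ} (e : κ ≃ ι)
    (h : ∀ n, ℓ (e n) = m n) : tubeSum ℓ = tubeSum m := by
  funext x
  rw [tubeSum, tubeSum, ← e.tsum_eq]
  simp_rw [h]

/-- The upper bound makes the content at D finite; for d < D the lower bound forces the ratio above
a multiple of ε^(d-D), which tends to infinity. -/
theorem minkowskiDim_eq {Ω : Set ℝ} (hΩ : IsOpen Ω) (hb : Bornology.IsBounded Ω) {D c C : ℝ}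
    (hD : 0 ≤ D) (hc : 0 < c)
    (hlow : ∀ᶠ δ in 𝓝[>] 0, c * δ ^ (1 - D) ≤ tubeSum (lengths Ω) δ)
    (hup : ∀ᶠ δ in 𝓝[>] 0, tubeSum (lengths Ω) δ ≤ C * δ ^ (1 - D)) : minkowskiDim Ω = D := by
  refine IsLeast.csInf_eq ⟨⟨hD, ?_⟩, ?_⟩
  · refine lt_of_le_of_lt (limsup_le_of_le (a := ENNReal.ofReal (C * 2 ^ (1 - D))) (by isBoundedDefault) ?_)
      ENNReal.ofReal_lt_top
    filter_upwards [tendsto_two_mul_nhdsGT_zero.eventually hup, self_mem_nhdsWithin] with ε h1 hε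
    have hε : (0 : ℝ) < ε := hε
    rw [tubeRatio_eq hΩ hb D hε]
    refine ENNReal.ofReal_le_ofReal ?_
    rw [div_le_iff₀ (Real.rpow_pos_of_pos hε _), mul_assoc, ← Real.mul_rpow zero_le_two hε.le]
    exact h1
  · rintro d ⟨-, hd⟩
    by_contra! hdD
    refine hd.ne ?_
    have ht : Tendsto (tubeRatio Ω d) (𝓝[>] 0) (𝓝 ⊤) := by
      have h1 : Tendsto (fun ε : ℝ => ENNReal.ofReal (c * 2 ^ (1 - D) * ε ^ (d - D))) (𝓝[>] 0)
          (𝓝 ⊤) := by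
        refine ENNReal.tendsto_ofReal_atTop.comp
          (Tendsto.const_mul_atTop (by positivity) (tendsto_rpow_neg_nhdsGT_zero (by linarith)))
      refine tendsto_nhds_top_mono h1 ?_
      filter_upwards [tendsto_two_mul_nhdsGT_zero.eventually hlow, self_mem_nhdsWithin] with ε h1 hε
      have hε : (0 : ℝ) < ε := hε
      rw [tubeRatio_eq hΩ hb d hε]
      refine ENNReal.ofReal_le_ofReal ?_
      rw [le_div_iff₀ (Real.rpow_pos_of_pos hε _), mul_assoc, ← Real.rpow_add hε,
        show d - D + (1 - d) = 1 - D by ring, mul_assoc, ← Real.mul_rpow zero_le_two hε.le]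
      exact h1
    exact ht.limsup_eq

theorem tendsto_of_isMinkowskiMeasurable {Ω : Set ℝ} (hΩ : IsOpen Ω) (hb : Bornology.IsBounded Ω)
    (h : IsMinkowskiMeasurable Ω) : ∃ L : ℝ, Tendsto
      (fun δ => tubeSum (lengths Ω) δ / δ ^ (1 - minkowskiDim Ω)) (𝓝[>] 0) (𝓝 L) := by
  obtain ⟨-, heq, hlt⟩ := h
  set D := minkowskiDim Ω
  have ht : Tendsto (tubeRatio Ω D) (𝓝[>] 0) (𝓝 (upperContent Ω D)) :=
    tendsto_of_liminf_eq_limsup heq rfl (by isBoundedDefault) (by isBoundedDefault)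
  have ht2 := (ENNReal.tendsto_toReal hlt.ne).comp ht
  have hhalf : Tendsto (fun δ : ℝ => δ / 2) (𝓝[>] 0) (𝓝[>] 0) := by
    refine tendsto_nhdsWithin_of_tendsto_nhds_of_eventually_within _ ?_ ?_
    · have : Continuous fun ε : ℝ => ε / 2 := by fun_prop
      simpa using (this.tendsto 0).mono_left nhdsWithin_le_nhds
    · filter_upwards [self_mem_nhdsWithin] with ε hε
      exact half_pos (mem_Ioi.1 hε)
  refine ⟨_, ((ht2.comp hhalf).const_mul ((2⁻¹ : ℝ) ^ (1 - D))).congr' ?_⟩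
  filter_upwards [self_mem_nhdsWithin] with δ hδ
  have hδ : (0 : ℝ) < δ := hδ
  have hnn : 0 ≤ tubeSum (lengths Ω) δ :=
    tsum_nonneg fun I => le_min (lengths_pos hΩ hb I).le hδ.le
  simp only [Function.comp]
  rw [tubeRatio_eq hΩ hb D (half_pos hδ), mul_div_cancel₀ _ two_ne_zero,
    ENNReal.toReal_ofReal (div_nonneg hnn (Real.rpow_nonneg (half_pos hδ).le _)),
    div_eq_inv_mul δ 2, Real.mul_rpow (by norm_num) hδ.le]
  have h2 : (2⁻¹ : ℝ) ^ (1 - D) ≠ 0 := (Real.rpow_pos_of_pos (by norm_num) _).ne'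
  have h3 : δ ^ (1 - D) ≠ 0 := (Real.rpow_pos_of_pos hδ _).ne'
  field_simp

end FractalString

/-! ### Lengths with an oscillating counting function -/

/-- A power `x ^ D` perturbed by a multiple of the real part of `x ^ s`. -/
noncomputable def oscPow (β D : ℝ) (s : ℂ) (x : ℝ) : ℝ := ((x : ℂ) ^ (D : ℂ) + β * (x : ℂ) ^ s).re

theorem oscPow_eq {β D : ℝ} {s : ℂ} {x : ℝ} (hx : 0 < x) :
    oscPow β D s x = x ^ D + β * ((x : ℂ) ^ s).re := by
  rw [oscPow, Complex.add_re, Complex.re_ofReal_mul, ← Complex.ofReal_cpow hx.le, Complex.ofReal_re]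

theorem abs_oscPow_sub_le {β D : ℝ} {s : ℂ} (hβ : 0 ≤ β) (hs : s.re = D) {x : ℝ} (hx : 0 < x) :
    |oscPow β D s x - x ^ D| ≤ β * x ^ D := by
  rw [oscPow_eq hx, add_sub_cancel_left, abs_mul, abs_of_nonneg hβ]
  refine mul_le_mul_of_nonneg_left ((Complex.abs_re_le_norm _).trans ?_) hβ
  rw [norm_cpow_real hx, hs]

theorem oscPow_exp {β D : ℝ} {s : ℂ} (hs : s.re = D) (t : ℝ) :
    oscPow β D s (Real.exp t) = Real.exp (D * t) * (1 + β * Real.cos (s.im * t)) := by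
  rw [oscPow_eq (Real.exp_pos t), ← Real.exp_mul, mul_comm t D, Complex.cpow_def_of_ne_zero (by simp),
    ← Complex.ofReal_log (Real.exp_pos t).le, Real.log_exp, Complex.exp_re]
  simp only [Complex.re_ofReal_mul, Complex.im_ofReal_mul, hs]
  rw [mul_comm t D, mul_comm t s.im]; ring

open Classical in
theorem tsum_ite_succ_le {u : ℝ} (hu : 0 ≤ u) :
    ∑' n : ℕ, (if ((n + 1 : ℕ) : ℝ) ≤ u then (1 : ℝ) else 0) = (⌊u⌋₊ : ℝ) := by
  rw [tsum_eq_sum (s := Finset.range ⌊u⌋₊)]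
  · rw [Finset.sum_congr rfl (g := fun _ => (1 : ℝ))]
    · simp
    · intro n hn
      rw [if_pos]
      exact (Nat.le_floor_iff hu).1 (Finset.mem_range.1 hn)
  · intro n hn
    rw [if_neg]
    intro h
    exact hn (Finset.mem_range.2 ((Nat.le_floor_iff hu).2 h))

/-- A sequence of lengths whose counting function is a power law with oscillations. -/
theorem exists_oscillating_lengths {D : ℝ} (h0 : 0 < D) (h1 : D < 1) {s : ℂ} (hs : s.re = D) :
    ∃ β : ℝ, 0 < β ∧ β ≤ 1 / 2 ∧ ∃ ℓ : ℕ → ℝ, (∀ n, 0 < ℓ n) ∧ Summable ℓ ∧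
      ∀ x > 0, oscPow β D s x - 1 ≤ countSum ℓ x ∧ countSum ℓ x ≤ oscPow β D s x := by
  classical
  set τ := s.im
  -- Chosen so that β(D + |τ|) = D/2: the oscillation takes at most half of the derivative of
  -- e^(Dt), and F stays strictly increasing.
  set β := D / (2 * (D + |τ|)) with hβdef
  have hden : 0 < D + |τ| := by positivity
  have hβ : 0 < β := by positivity
  have hβ2 : β ≤ 1 / 2 := by
    rw [hβdef, div_le_div_iff₀ (by positivity) two_pos]
    linarith [abs_nonneg τ]
  have hβ3 : β * (D + |τ|) = D / 2 := by rw [hβdef]; field_simp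
  set F : ℝ → ℝ := fun t => Real.exp (D * t) * (1 + β * Real.cos (τ * t)) with hF
  have hFd : ∀ t, HasDerivAt F (Real.exp (D * t) * (D + β * (D * Real.cos (τ * t)
      - τ * Real.sin (τ * t)))) t := by
    intro t
    have e1 : HasDerivAt (fun t => Real.exp (D * t)) (Real.exp (D * t) * (D * 1)) t :=
      ((hasDerivAt_id t).const_mul D).exp
    have e2 : HasDerivAt (fun t => 1 + β * Real.cos (τ * t))
        (β * (-Real.sin (τ * t) * (τ * 1))) t :=
      ((((hasDerivAt_id t).const_mul τ).cos).const_mul β).const_add 1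
    refine (e1.mul e2).congr_deriv ?_
    ring
  have hmono : StrictMono F := by
    refine strictMono_of_hasDerivAt_pos hFd fun t => mul_pos (Real.exp_pos _) ?_
    have h2 : |D * Real.cos (τ * t) - τ * Real.sin (τ * t)| ≤ D + |τ| := by
      refine (abs_sub _ _).trans (add_le_add ?_ ?_)
      · rw [abs_mul, abs_of_pos h0]
        exact mul_le_of_le_one_right h0.le (Real.abs_cos_le_one _)
      · rw [abs_mul]
        exact mul_le_of_le_one_right (abs_nonneg _) (Real.abs_sin_le_one _)
    have h3 := mul_le_mul_of_nonneg_left (neg_le_of_abs_le h2) hβ.le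
    nlinarith
  have hcont : Continuous F := by fun_prop
  have hFle : ∀ t, F t ≤ 2 * Real.exp (D * t) := by
    intro t
    have := mul_le_mul_of_nonneg_left (Real.cos_le_one (τ * t)) hβ.le
    have := mul_le_mul_of_nonneg_left (show 1 + β * Real.cos (τ * t) ≤ 2 by linarith)
      (Real.exp_pos (D * t)).le
    simp only [hF]; linarith
  have hFge : ∀ t, Real.exp (D * t) / 2 ≤ F t := by
    intro t
    have := mul_le_mul_of_nonneg_left (Real.neg_one_le_cos (τ * t)) hβ.le
    have := mul_le_mul_of_nonneg_left (show 1 / 2 ≤ 1 + β * Real.cos (τ * t) by linarith)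
      (Real.exp_pos (D * t)).le
    simp only [hF]; linarith
  have hex : ∀ y : ℝ, 0 < y → ∃ t, F t = y := by
    intro y hy
    refine mem_range_of_exists_le_of_exists_ge hcont ⟨Real.log (y / 2) / D, ?_⟩
      ⟨Real.log (2 * y) / D, ?_⟩
    · refine (hFle _).trans ?_
      rw [mul_div_cancel₀ _ h0.ne', Real.exp_log (by positivity)]; linarith
    · refine le_trans ?_ (hFge _)
      rw [mul_div_cancel₀ _ h0.ne', Real.exp_log (by positivity)]; linarith
  -- F(t_n) = n + 1 and ℓ_n = e^(-t_n), so exactly ⌊F(log x)⌋ lengths satisfy ℓ_n x ≥ 1.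
  choose t ht using fun n : ℕ => hex ((n + 1 : ℕ) : ℝ) (by positivity)
  have hpos : ∀ n, 0 < Real.exp (-t n) := fun n => Real.exp_pos _
  refine ⟨β, hβ, hβ2, fun n => Real.exp (-t n), hpos, ?_, ?_⟩
  -- F ≤ 2e^(Dt) gives ℓ_n ≤ (2/(n+1))^(1/D), summable because 1/D > 1.
  · have hsum : Summable fun n : ℕ => (2 : ℝ) ^ (1 / D) * (1 / ((n + 1 : ℕ) : ℝ) ^ (1 / D)) :=
      (((Real.summable_one_div_nat_rpow (p := 1 / D)).2 (by
        rw [lt_div_iff₀ h0]; linarith)).comp_injective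
          (add_left_injective 1)).mul_left _
    refine Summable.of_nonneg_of_le (fun n => (hpos n).le) (fun n => ?_) hsum
    have hn : (0 : ℝ) < ((n + 1 : ℕ) : ℝ) := by positivity
    have h2 := hFle (t n)
    rw [ht n] at h2
    have h3 : (((n + 1 : ℕ) : ℝ) / 2) ^ (1 / D) ≤ Real.exp (t n) := by
      calc _ ≤ Real.exp (D * t n) ^ (1 / D) :=
            Real.rpow_le_rpow (by positivity) (by linarith) (by positivity)
        _ = _ := by rw [← Real.exp_mul]; congr 1; field_simp
    rw [Real.div_rpow hn.le zero_le_two] at h3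
    have h4 : 0 < ((n + 1 : ℕ) : ℝ) ^ (1 / D) := Real.rpow_pos_of_pos hn _
    rw [Real.exp_neg, inv_le_iff_one_le_mul₀ (Real.exp_pos _)]
    have h5 : 0 < (2 : ℝ) ^ (1 / D) := Real.rpow_pos_of_pos two_pos _
    rw [div_le_iff₀ h5] at h3
    rw [mul_one_div, div_mul_eq_mul_div, le_div_iff₀ h4, one_mul, mul_comm]
    exact h3
  · intro x hx
    have hxF : oscPow β D s x = F (Real.log x) := by
      have := oscPow_exp (β := β) hs (Real.log x)
      rwa [Real.exp_log hx] at this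
    have hF0 : 0 ≤ F (Real.log x) := le_trans (by positivity) (hFge _)
    have hcount : countSum (fun n => Real.exp (-t n)) x = (⌊F (Real.log x)⌋₊ : ℝ) := by
      rw [← tsum_ite_succ_le hF0, countSum]
      refine tsum_congr fun n => ?_
      have : 1 ≤ Real.exp (-t n) * x ↔ ((n + 1 : ℕ) : ℝ) ≤ F (Real.log x) := by
        rw [← ht n, hmono.le_iff_le, Real.le_log_iff_exp_le hx, Real.exp_neg, inv_mul_eq_div,
          one_le_div (Real.exp_pos _)]
      simp only [this]
    rw [hcount, hxF]
    exact ⟨by linarith [Nat.lt_floor_add_one (F (Real.log x))], Nat.floor_le hF0⟩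

/-! ### Fractional sums from tube and counting functions -/

section Comparison

variable {ℓ : ℕ → ℝ} {β D : ℝ} {s : ℂ}

theorem integral_inv_cpow {w : ℂ} (hw : w.re < 1) {δ : ℝ} (hδ : 0 < δ) :
    IntervalIntegrable (fun t : ℝ => ((t⁻¹ : ℝ) : ℂ) ^ w) volume 0 δ ∧
    ∫ t in (0 : ℝ)..δ, ((t⁻¹ : ℝ) : ℂ) ^ w = (δ : ℂ) ^ (1 - w) / (1 - w) := by
  have hw1 : 1 - w ≠ 0 := fun h => by
    have := congrArg Complex.re h; simp at this; linarith
  have e : EqOn (fun t : ℝ => (t : ℂ) ^ (-w)) (fun t : ℝ => ((t⁻¹ : ℝ) : ℂ) ^ w) (uIoc 0 δ) := by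
    intro t ht
    rw [uIoc_of_le hδ.le] at ht
    simp only
    rw [Complex.ofReal_inv, Complex.inv_cpow _ _ (by
      rw [Complex.arg_ofReal_of_nonneg ht.1.le]; exact Real.pi_ne_zero.symm), Complex.cpow_neg]
  refine ⟨(intervalIntegral.intervalIntegrable_cpow' (by simpa using hw)).congr e, ?_⟩
  rw [← intervalIntegral.integral_congr_ae (ae_of_all _ e), integral_cpow (Or.inl (by simpa using hw)),
    show -w + 1 = 1 - w by ring, Complex.ofReal_zero, Complex.zero_cpow hw1, sub_zero]

theorem integral_oscPow (h1 : D < 1) (hs : s.re = D) {δ : ℝ} (hδ : 0 < δ) :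
    IntervalIntegrable (fun t => oscPow β D s t⁻¹) volume 0 δ ∧
    ∫ t in (0 : ℝ)..δ, oscPow β D s t⁻¹ =
      ((δ : ℂ) ^ (1 - (D : ℂ)) / (1 - D) + β * ((δ : ℂ) ^ (1 - s) / (1 - s))).re := by
  obtain ⟨i1, e1⟩ := integral_inv_cpow (w := D) (by simpa using h1) hδ
  obtain ⟨i2, e2⟩ := integral_inv_cpow (w := s) (by rwa [hs]) hδ
  have i3 := i1.add (i2.const_mul (β : ℂ))
  have h := Complex.reCLM.intervalIntegral_comp_comm i3
  rw [intervalIntegral.integral_add i1 (i2.const_mul _), intervalIntegral.integral_const_mul, e1,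
    e2] at h
  refine ⟨?_, h⟩
  exact ⟨Complex.reCLM.integrable_comp i3.1, Complex.reCLM.integrable_comp i3.2⟩

/-- The count is within 1 of `oscPow`; integrating over (0, δ) costs at most δ. -/
theorem abs_tubeSum_sub_le (h1 : D < 1) (hs : s.re = D) (hpos : ∀ n, 0 < ℓ n) (hsum : Summable ℓ)
    (hcount : ∀ x > 0, oscPow β D s x - 1 ≤ countSum ℓ x ∧ countSum ℓ x ≤ oscPow β D s x)
    {δ : ℝ} (hδ : 0 < δ) :
    |tubeSum ℓ δ - ((δ : ℂ) ^ (1 - (D : ℂ)) / (1 - D) + β * ((δ : ℂ) ^ (1 - s) / (1 - s))).re|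
      ≤ δ := by
  obtain ⟨i1, e1⟩ := tubeSum_eq_integral hpos hsum hδ
  obtain ⟨i2, e2⟩ := integral_oscPow (β := β) h1 hs hδ
  rw [e1, ← e2, ← intervalIntegral.integral_sub i1 i2]
  have := intervalIntegral.norm_integral_le_of_norm_le_const (a := 0) (b := δ) (C := 1)
    (f := fun t => countSum ℓ t⁻¹ - oscPow β D s t⁻¹) (fun t ht => ?_)
  · rwa [one_mul, sub_zero, abs_of_pos hδ] at this
  · rw [uIoc_of_le hδ.le] at ht
    have := hcount t⁻¹ (inv_pos.2 ht.1)
    rw [Real.norm_eq_abs, abs_le]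
    constructor <;> linarith [this.1, this.2]

open Classical in
-- For y < k the bracket is y - ⌊y⌋ exactly; for y ≥ k it is k - k = 0, and {y} < 1.
theorem abs_fract_sub_le {y : ℝ} (hy : 0 ≤ y) (k : ℕ) :
    |Int.fract y - (min y k - ∑ n ∈ Finset.Icc 1 k, if (n : ℝ) ≤ y then (1 : ℝ) else 0)| ≤
      if (k : ℝ) ≤ y then 1 else 0 := by
  have hsum : ∑ n ∈ Finset.Icc 1 k, (if (n : ℝ) ≤ y then (1 : ℝ) else 0) =
      ((min ⌊y⌋₊ k : ℕ) : ℝ) := by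
    rw [Finset.sum_ite, Finset.sum_const_zero, add_zero, Finset.sum_const, nsmul_eq_mul, mul_one]
    congr 1
    have : (Finset.Icc 1 k).filter (fun n : ℕ => (n : ℝ) ≤ y) = Finset.Icc 1 (min ⌊y⌋₊ k) := by
      ext n
      simp only [Finset.mem_filter, Finset.mem_Icc, le_min_iff, Nat.le_floor_iff hy]
      tauto
    rw [this, Nat.card_Icc, Nat.add_sub_cancel]
  rw [hsum]
  split_ifs with h
  · rw [min_eq_right h, min_eq_right (Nat.le_floor h), sub_self, sub_zero,
      abs_of_nonneg (Int.fract_nonneg _)]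
    exact (Int.fract_lt_one _).le
  · rw [not_le] at h
    have : ⌊y⌋₊ ≤ k := by
      have := Nat.floor_le hy
      exact_mod_cast this.trans h.le
    rw [min_eq_left h.le, min_eq_left this, natCast_floor_eq_intCast_floor hy, Int.self_sub_floor,
      sub_self, abs_zero]

theorem abs_fractSum_sub_le {ι : Type*} {ℓ : ι → ℝ} (hpos : ∀ n, 0 < ℓ n) (hsum : Summable ℓ)
    {x : ℝ} (hx : 0 < x) {k : ℕ} (hk : 1 ≤ k) :
    |fractSum ℓ x - (x * tubeSum ℓ (k / x) - ∑ n ∈ Finset.Icc 1 k, countSum ℓ (x / n))| ≤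
      countSum ℓ (x / k) := by
  classical
  have hc : ∀ n : ℕ, 1 ≤ n → ∀ j, (1 ≤ ℓ j * (x / n) ↔ (n : ℝ) ≤ ℓ j * x) := by
    intro n hn j
    have : (0 : ℝ) < n := by exact_mod_cast hn
    rw [mul_div_assoc', one_le_div this]
  have hcs : ∀ n : ℕ, 1 ≤ n → HasSum (fun j => if (n : ℝ) ≤ ℓ j * x then (1 : ℝ) else 0)
      (countSum ℓ (x / n)) := by
    intro n hn
    have := (summable_count hpos hsum (x := x / n) (by positivity)).hasSum
    simp only [hc n hn] at this
    rw [countSum]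
    simp only [hc n hn]
    exact this
  have hk0 : (0 : ℝ) < k := by exact_mod_cast hk
  have ht : HasSum (fun j => min (ℓ j * x) k) (x * tubeSum ℓ (k / x)) := by
    have := (summable_tube hpos hsum (δ := k / x) (by positivity)).hasSum.mul_left x
    refine this.congr_fun fun j => ?_
    rw [mul_min_of_nonneg _ _ hx.le, mul_div_cancel₀ _ hx.ne', mul_comm]
  have hf := (summable_fract hpos hsum hx.le).hasSum
  have hall := hf.sub (ht.sub (hasSum_sum (s := Finset.Icc 1 k) fun n hn => hcs n (Finset.mem_Icc.1 hn).1))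
  have hpt := fun j => abs_le.1 (abs_fract_sub_le (mul_nonneg (hpos j).le hx.le) k)
  rw [abs_le]
  exact ⟨hasSum_le (fun j => (hpt j).1) (hcs k hk).neg hall,
    hasSum_le (fun j => (hpt j).2) hall (hcs k hk)⟩

end Comparison

/-- By homogeneity a count x^w enters the truncated formula for the fractional sum as x^w times the
defect at k, whose limit in the strip is -ζ(w). -/
theorem powDefect_scale {x : ℝ} (hx : 0 < x) {k : ℕ} (hk : 1 ≤ k) (w : ℂ) :
    x * (((k / x : ℝ) : ℂ) ^ (1 - w) / (1 - w)) - ∑ n ∈ Finset.Icc 1 k, ((x / n : ℝ) : ℂ) ^ w =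
      (x : ℂ) ^ w * powDefect w k := by
  have hx0 : (x : ℂ) ≠ 0 := by exact_mod_cast hx.ne'
  have hinv : ∀ y : ℝ, 0 < y → ∀ v : ℂ, ((y⁻¹ : ℝ) : ℂ) ^ v = (y : ℂ) ^ (-v) := by
    intro y hy v
    rw [Complex.ofReal_inv, Complex.inv_cpow _ _ (by
      rw [Complex.arg_ofReal_of_nonneg hy.le]; exact Real.pi_ne_zero.symm), Complex.cpow_neg]
  have h1 : x * ((k / x : ℝ) : ℂ) ^ (1 - w) = (x : ℂ) ^ w * (k : ℂ) ^ (1 - w) := by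
    rw [div_eq_mul_inv, Complex.ofReal_mul, Complex.mul_cpow_ofReal_nonneg (by positivity)
      (by positivity), hinv x hx, neg_sub, Complex.cpow_sub _ _ hx0, Complex.cpow_one]
    push_cast
    field_simp
  have h2 : ∀ n ∈ Finset.Icc 1 k, ((x / n : ℝ) : ℂ) ^ w = (x : ℂ) ^ w * (n : ℂ) ^ (-w) := by
    intro n hn
    have hn0 : (0 : ℝ) < n := by exact_mod_cast (Finset.mem_Icc.1 hn).1
    rw [div_eq_mul_inv, Complex.ofReal_mul, Complex.mul_cpow_ofReal_nonneg hx.le (by positivity),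
      hinv n hn0]
    push_cast; rfl
  rw [Finset.sum_congr rfl h2, ← Finset.mul_sum, mul_div_assoc', h1, powDefect]
  ring

/-! ### The oscillation is absent from the spectrum, present in the tube -/

section Oscillating

variable {ℓ : ℕ → ℝ} {β D : ℝ} {s : ℂ}

/-- The three errors are the oscillating term, the truncation at k, and the rounding of the count: k
from the tube integral and 1 for each n ≤ k. -/
theorem abs_fractSum_sub_powDefect_le (h1 : D < 1) (hs : s.re = D) (hβ : 0 ≤ β) (hβ1 : β ≤ 1)
    (hpos : ∀ n, 0 < ℓ n) (hsum : Summable ℓ)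
    (hcount : ∀ x > 0, oscPow β D s x - 1 ≤ countSum ℓ x ∧ countSum ℓ x ≤ oscPow β D s x)
    {x : ℝ} (hx : 0 < x) {k : ℕ} (hk : 1 ≤ k) :
    |fractSum ℓ x - x ^ D * (powDefect D k).re| ≤
      x ^ D * ‖powDefect s k‖ + 2 * (x ^ D * (k : ℝ) ^ (-D)) + 2 * k := by
  have hk0 : (0 : ℝ) < k := by exact_mod_cast hk
  have hxD : 0 < x ^ D := Real.rpow_pos_of_pos hx D
  have e1 := abs_fractSum_sub_le hpos hsum hx hk
  have e2 : countSum ℓ (x / k) ≤ 2 * (x ^ D * (k : ℝ) ^ (-D)) := by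
    have hxk : 0 < x / k := by positivity
    have a1 := (abs_le.1 (abs_oscPow_sub_le (β := β) hβ hs hxk)).2
    have a2 : (x / k) ^ D = x ^ D * (k : ℝ) ^ (-D) := by
      rw [Real.div_rpow hx.le hk0.le, Real.rpow_neg hk0.le]; rfl
    have a3 := (hcount _ hxk).2
    have a4 : 0 ≤ x ^ D * (k : ℝ) ^ (-D) := by positivity
    rw [a2] at a1
    nlinarith
  set M : ℝ → ℝ := fun δ =>
    ((δ : ℂ) ^ (1 - (D : ℂ)) / (1 - D) + β * ((δ : ℂ) ^ (1 - s) / (1 - s))).re with hM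
  have e3 : |x * tubeSum ℓ (k / x) - x * M (k / x)| ≤ k := by
    have := abs_tubeSum_sub_le h1 hs hpos hsum hcount (δ := k / x) (by positivity)
    rw [← mul_sub, abs_mul, abs_of_pos hx]
    calc _ ≤ x * (k / x) := mul_le_mul_of_nonneg_left this hx.le
      _ = k := by field_simp
  have e4 : |∑ n ∈ Finset.Icc 1 k, countSum ℓ (x / n) - ∑ n ∈ Finset.Icc 1 k, oscPow β D s (x / n)|
      ≤ k := by
    rw [← Finset.sum_sub_distrib]
    refine (Finset.abs_sum_le_sum_abs _ _).trans ?_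
    calc _ ≤ ∑ n ∈ Finset.Icc 1 k, (1 : ℝ) := by
          refine Finset.sum_le_sum fun n hn => ?_
          have hn0 : (0 : ℝ) < n := by exact_mod_cast (Finset.mem_Icc.1 hn).1
          have := hcount (x / n) (by positivity)
          rw [abs_le]; constructor <;> linarith [this.1, this.2]
      _ = k := by simp
  have e5 : x * M (k / x) - ∑ n ∈ Finset.Icc 1 k, oscPow β D s (x / n) =
      x ^ D * (powDefect D k).re + β * ((x : ℂ) ^ s * powDefect s k).re := by
    have c1 := powDefect_scale hx hk (D : ℂ)
    have c2 := powDefect_scale hx hk s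
    have : ((x * M (k / x) - ∑ n ∈ Finset.Icc 1 k, oscPow β D s (x / n) : ℝ)) =
        ((x : ℂ) ^ (D : ℂ) * powDefect D k + β * ((x : ℂ) ^ s * powDefect s k)).re := by
      rw [← c1, ← c2]
      have : (x : ℂ) * (((k / x : ℝ) : ℂ) ^ (1 - (D : ℂ)) / (1 - D)) -
          ∑ n ∈ Finset.Icc 1 k, ((x / n : ℝ) : ℂ) ^ (D : ℂ) +
          β * (x * (((k / x : ℝ) : ℂ) ^ (1 - s) / (1 - s)) -
            ∑ n ∈ Finset.Icc 1 k, ((x / n : ℝ) : ℂ) ^ s) =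
          x * (((k / x : ℝ) : ℂ) ^ (1 - (D : ℂ)) / (1 - D) +
            β * (((k / x : ℝ) : ℂ) ^ (1 - s) / (1 - s))) -
          ∑ n ∈ Finset.Icc 1 k, (((x / n : ℝ) : ℂ) ^ (D : ℂ) + β * ((x / n : ℝ) : ℂ) ^ s) := by
        rw [Finset.sum_add_distrib, ← Finset.mul_sum]; ring
      rw [this, Complex.sub_re, Complex.re_ofReal_mul, Complex.re_sum]
      rfl
    rw [this, Complex.add_re, Complex.re_ofReal_mul, ← Complex.ofReal_cpow hx.le,
      Complex.re_ofReal_mul]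
  have e6 : |β * ((x : ℂ) ^ s * powDefect s k).re| ≤ x ^ D * ‖powDefect s k‖ := by
    rw [abs_mul, abs_of_nonneg hβ]
    have b1 := Complex.abs_re_le_norm ((x : ℂ) ^ s * powDefect s k)
    rw [norm_mul, norm_cpow_real hx, hs] at b1
    have b2 : 0 ≤ x ^ D * ‖powDefect s k‖ := by positivity
    nlinarith [abs_nonneg ((x : ℂ) ^ s * powDefect s k).re]
  rw [abs_le] at *
  constructor <;> linarith [e1.1, e1.2, e3.1, e3.2, e4.1, e4.2, e6.1, e6.2]

/-- The order of choices matters: k is fixed first, making the defect at s small because ζ(s) = 0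
and k^(-D) small; then x grows and 2k x^(-D) vanishes. -/
theorem tendsto_fractSum_of_zero (h0 : 0 < D) (h1 : D < 1) (hs : s.re = D)
    (hz : riemannZeta s = 0) (hβ : 0 ≤ β) (hβ1 : β ≤ 1)
    (hpos : ∀ n, 0 < ℓ n) (hsum : Summable ℓ)
    (hcount : ∀ x > 0, oscPow β D s x - 1 ≤ countSum ℓ x ∧ countSum ℓ x ≤ oscPow β D s x) :
    Tendsto (fun x => fractSum ℓ x / x ^ D) atTop (𝓝 (-(riemannZeta D).re)) := by
  rw [Metric.tendsto_nhds]
  intro ε hε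
  have t1 : Tendsto (fun k => (powDefect D k).re) atTop (𝓝 (-(riemannZeta D).re)) := by
    have := (Complex.continuous_re.tendsto _).comp
      (tendsto_powDefect (s := D) (by simpa using h0) (by simpa using h1))
    simpa [Function.comp_def] using this
  have t2 : Tendsto (fun k => ‖powDefect s k‖) atTop (𝓝 0) := by
    have := (tendsto_powDefect (s := s) (by rwa [hs]) (by rwa [hs])).norm
    simpa [hz] using this
  have t3 : Tendsto (fun k : ℕ => (k : ℝ) ^ (-D)) atTop (𝓝 0) :=
    (tendsto_rpow_neg_atTop h0).comp tendsto_natCast_atTop_atTop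
  obtain ⟨k, ⟨⟨k1, k2⟩, k3⟩, k4⟩ := (((Metric.tendsto_nhds.1 t1 (ε / 4) (by positivity)).and
    (t2.eventually (gt_mem_nhds (show 0 < ε / 4 by positivity)))).and
    (t3.eventually (gt_mem_nhds (show 0 < ε / 8 by positivity)))).and
    (eventually_ge_atTop 1) |>.exists
  have t4 : Tendsto (fun x : ℝ => 2 * (k : ℝ) * x ^ (-D)) atTop (𝓝 0) := by
    simpa using (tendsto_rpow_neg_atTop h0).const_mul (2 * (k : ℝ))
  filter_upwards [t4.eventually (gt_mem_nhds (show 0 < ε / 4 by positivity)),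
    eventually_gt_atTop 0] with x hx hx0
  have hxD : 0 < x ^ D := Real.rpow_pos_of_pos hx0 D
  have hmain := abs_fractSum_sub_powDefect_le h1 hs hβ hβ1 hpos hsum hcount hx0 k4
  have hdiv : |fractSum ℓ x / x ^ D - (powDefect D k).re| ≤
      ‖powDefect s k‖ + 2 * (k : ℝ) ^ (-D) + 2 * k * x ^ (-D) := by
    have : fractSum ℓ x / x ^ D - (powDefect D k).re =
        (fractSum ℓ x - x ^ D * (powDefect D k).re) / x ^ D := by field_simp
    rw [this, abs_div, abs_of_pos hxD, div_le_iff₀ hxD]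
    refine hmain.trans (le_of_eq ?_)
    rw [Real.rpow_neg hx0.le]
    field_simp
  rw [Real.dist_eq] at k1 ⊢
  have := abs_sub_le (fractSum ℓ x / x ^ D) (powDefect D k).re (-(riemannZeta D).re)
  linarith

theorem tubeSum_bounds (h0 : 0 < D) (h1 : D < 1) (hs : s.re = D) (hβ : 0 ≤ β) (hβ1 : β ≤ 1 / 2)
    (hpos : ∀ n, 0 < ℓ n) (hsum : Summable ℓ)
    (hcount : ∀ x > 0, oscPow β D s x - 1 ≤ countSum ℓ x ∧ countSum ℓ x ≤ oscPow β D s x) :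
    (∀ᶠ δ in 𝓝[>] 0, 1 / (4 * (1 - D)) * δ ^ (1 - D) ≤ tubeSum ℓ δ) ∧
    (∀ᶠ δ in 𝓝[>] 0, tubeSum ℓ δ ≤ 2 / (1 - D) * δ ^ (1 - D)) := by
  have h1D : 0 < 1 - D := by linarith
  have hb : ∀ t : ℝ, 0 < t → 1 / 2 * t⁻¹ ^ D - 1 ≤ countSum ℓ t⁻¹ ∧
      countSum ℓ t⁻¹ ≤ 2 * t⁻¹ ^ D := by
    intro t ht
    have hti := inv_pos.2 ht
    have a1 := abs_le.1 (abs_oscPow_sub_le (β := β) hβ hs hti)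
    have a2 := hcount _ hti
    have a3 : 0 < t⁻¹ ^ D := Real.rpow_pos_of_pos hti D
    constructor <;> nlinarith [a1.1, a1.2, a2.1, a2.2]
  constructor
  -- The rounding term -1 integrates to -δ, at most a quarter of δ^(1-D) once δ^D < 1/4.
  · have hsmall : ∀ᶠ δ : ℝ in 𝓝[>] 0, δ ^ D < 1 / 4 := by
      have : Tendsto (fun δ : ℝ => δ ^ D) (𝓝[>] 0) (𝓝 0) := by
        have := (Real.continuousAt_rpow_const 0 D (Or.inr h0.le)).tendsto
        rw [Real.zero_rpow h0.ne'] at this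
        exact this.mono_left nhdsWithin_le_nhds
      exact this.eventually (gt_mem_nhds (by norm_num))
    filter_upwards [hsmall, self_mem_nhdsWithin] with δ hδ4 hδ
    have hδ : (0 : ℝ) < δ := hδ
    obtain ⟨i1, e1⟩ := tubeSum_eq_integral hpos hsum hδ
    obtain ⟨i2, e2⟩ := integral_inv_rpow h1 hδ
    have hle := intervalIntegral.integral_mono_on_of_le_Ioo hδ.le
      ((i2.const_mul (1 / 2)).sub (intervalIntegrable_const (c := (1 : ℝ)))) i1
      (fun t ht => (hb t ht.1).1)
    rw [intervalIntegral.integral_sub (i2.const_mul _) intervalIntegrable_const,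
      intervalIntegral.integral_const_mul, e2, ← e1, intervalIntegral.integral_const, sub_zero,
      smul_eq_mul, mul_one] at hle
    refine le_trans ?_ hle
    have hsplit : δ = δ ^ D * δ ^ (1 - D) := by
      rw [← Real.rpow_add hδ]; simp
    have hp : 0 < δ ^ (1 - D) := Real.rpow_pos_of_pos hδ _
    have h4 : δ ≤ 1 / 4 * δ ^ (1 - D) := by
      calc δ = δ ^ D * δ ^ (1 - D) := hsplit
        _ ≤ _ := mul_le_mul_of_nonneg_right hδ4.le hp.le
    have h5 : δ ^ (1 - D) ≤ δ ^ (1 - D) / (1 - D) := by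
      rw [le_div_iff₀ h1D]; nlinarith
    have h6 : 1 / (4 * (1 - D)) * δ ^ (1 - D) = 1 / 4 * (δ ^ (1 - D) / (1 - D)) := by
      field_simp
    rw [h6]; linarith
  · filter_upwards [self_mem_nhdsWithin] with δ hδ
    have hδ : (0 : ℝ) < δ := hδ
    obtain ⟨i1, e1⟩ := tubeSum_eq_integral hpos hsum hδ
    obtain ⟨i2, e2⟩ := integral_inv_rpow h1 hδ
    have hle := intervalIntegral.integral_mono_on_of_le_Ioo hδ.le i1 (i2.const_mul 2)
      (fun t ht => (hb t ht.1).2)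
    rw [intervalIntegral.integral_const_mul, e2, ← e1] at hle
    refine hle.trans (le_of_eq ?_)
    ring

theorem not_tendsto_tubeSum (h0 : 0 < D) (h1 : D < 1) (hs : s.re = D) (hτ : s.im ≠ 0) (hβ : 0 < β)
    (hpos : ∀ n, 0 < ℓ n) (hsum : Summable ℓ)
    (hcount : ∀ x > 0, oscPow β D s x - 1 ≤ countSum ℓ x ∧ countSum ℓ x ≤ oscPow β D s x) (L : ℝ) :
    ¬ Tendsto (fun δ => tubeSum ℓ δ / δ ^ (1 - D)) (𝓝[>] 0) (𝓝 L) := by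
  intro hL
  -- Half a period of the oscillation on the logarithmic scale: along e^(-an), the factor δ^(1-s) is
  -- (-1)^n δ^(1-D). The ratio then has limits 1/(1-D) ± βw along even and odd n, distinct since w >
  -- 0.
  set a : ℝ := Real.pi / |s.im|
  have ha : 0 < a := div_pos Real.pi_pos (abs_pos.2 hτ)
  set u : ℕ → ℝ := fun n => Real.exp (-(a * n)) with hu
  have hu0 : ∀ n, 0 < u n := fun n => Real.exp_pos _
  have hut0 : Tendsto u atTop (𝓝 0) := by
    refine Real.tendsto_exp_atBot.comp (tendsto_neg_atTop_atBot.comp ?_)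
    exact tendsto_natCast_atTop_atTop.const_mul_atTop ha
  have hut : Tendsto u atTop (𝓝[>] 0) :=
    tendsto_nhdsWithin_of_tendsto_nhds_of_eventually_within _ hut0 (Eventually.of_forall hu0)
  set w : ℝ := (1 / (1 - s)).re with hw
  have hs1 : 1 - s ≠ 0 := fun h => by
    have := congrArg Complex.re h; simp [hs] at this; linarith
  have hw0 : 0 < w := by
    rw [hw, one_div, Complex.inv_re]
    refine div_pos ?_ (Complex.normSq_pos.2 hs1)
    simp [hs]; linarith
  have hpow : ∀ n, ((u n : ℝ) : ℂ) ^ (1 - s) = ((u n ^ (1 - D) * (-1) ^ n : ℝ) : ℂ) := by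
    intro n
    have hlog : Complex.log (u n : ℂ) = ((-(a * n) : ℝ) : ℂ) := by
      rw [← Complex.ofReal_log (hu0 n).le, hu, Real.log_exp]
    have hsplit : s = D + s.im * Complex.I := by rw [← hs]; exact (Complex.re_add_im s).symm
    have hosc : Complex.exp ((a * n * s.im : ℝ) * Complex.I) = (-1) ^ n := by
      rcases abs_choice s.im with h | h
      · have : a * s.im = Real.pi := by simp only [a]; rw [h]; field_simp
        rw [show a * n * s.im = n * (a * s.im) by ring, this, ← Complex.exp_pi_mul_I,
          ← Complex.exp_nat_mul]
        push_cast; ring_nf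
      · have : a * s.im = -Real.pi := by simp only [a]; rw [h]; field_simp
        have e : (-1 : ℂ) = Complex.exp (-(Real.pi * Complex.I)) := by
          rw [Complex.exp_neg, Complex.exp_pi_mul_I]; norm_num
        rw [show a * n * s.im = n * (a * s.im) by ring, this, e, ← Complex.exp_nat_mul]
        push_cast; ring_nf
    rw [Complex.cpow_def_of_ne_zero (by exact_mod_cast (hu0 n).ne'), hlog]
    have e1 : ((-(a * n) : ℝ) : ℂ) * (1 - s) =
        ((-(a * n) * (1 - D) : ℝ) : ℂ) + (a * n * s.im : ℝ) * Complex.I := by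
      conv_lhs => rw [hsplit]
      push_cast; ring
    rw [e1, Complex.exp_add, hosc, ← Complex.ofReal_exp]
    have e2 : u n ^ (1 - D) = Real.exp (-(a * n) * (1 - D)) := by rw [hu, ← Real.exp_mul]
    rw [e2]; push_cast; rfl
  have hest : ∀ n, |tubeSum ℓ (u n) / u n ^ (1 - D) - (1 / (1 - D) + β * ((-1) ^ n * w))| ≤
      u n ^ D := by
    intro n
    have h := abs_tubeSum_sub_le h1 hs hpos hsum hcount (hu0 n)
    have hp : 0 < u n ^ (1 - D) := Real.rpow_pos_of_pos (hu0 n) _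
    have e : (((u n : ℝ) : ℂ) ^ (1 - (D : ℂ)) / (1 - D) +
        β * (((u n : ℝ) : ℂ) ^ (1 - s) / (1 - s))).re =
        u n ^ (1 - D) * (1 / (1 - D) + β * ((-1) ^ n * w)) := by
      rw [hpow, Complex.add_re, Complex.re_ofReal_mul, div_eq_mul_one_div _ (1 - s),
        Complex.re_ofReal_mul]
      have : ((u n : ℝ) : ℂ) ^ (1 - (D : ℂ)) / (1 - D) = ((u n ^ (1 - D) / (1 - D) : ℝ) : ℂ) := by
        rw [Complex.ofReal_div, Complex.ofReal_cpow (hu0 n).le]; push_cast; rfl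
      rw [this, Complex.ofReal_re]; ring
    rw [e] at h
    have e3 : tubeSum ℓ (u n) / u n ^ (1 - D) - (1 / (1 - D) + β * ((-1) ^ n * w)) =
        (tubeSum ℓ (u n) - u n ^ (1 - D) * (1 / (1 - D) + β * ((-1) ^ n * w))) / u n ^ (1 - D) := by
      rw [sub_div, mul_div_cancel_left₀ _ hp.ne']
    rw [e3, abs_div, abs_of_pos hp, div_le_iff₀ hp, ← Real.rpow_add (hu0 n)]
    simpa using h
  have hsm : Tendsto (fun n => u n ^ D) atTop (𝓝 0) := by
    have := (Real.continuousAt_rpow_const 0 D (Or.inr h0.le)).tendsto.comp hut0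
    rwa [Real.zero_rpow h0.ne'] at this
  have hd := squeeze_zero_norm (f := fun n => tubeSum ℓ (u n) / u n ^ (1 - D) -
    (1 / (1 - D) + β * ((-1) ^ n * w))) hest hsm
  have hosc := (hL.comp hut).sub hd
  simp only [Function.comp, sub_sub_cancel, sub_zero] at hosc
  have heven := hosc.comp (tendsto_id.const_mul_atTop' (show 0 < 2 by norm_num) : Tendsto
    (fun n : ℕ => 2 * n) atTop atTop)
  have hodd := hosc.comp ((tendsto_add_atTop_nat 1).comp
    (tendsto_id.const_mul_atTop' (show 0 < 2 by norm_num) : Tendsto (fun n : ℕ => 2 * n) atTop atTop))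
  have v1 : L = 1 / (1 - D) + β * w := by
    refine tendsto_nhds_unique heven (tendsto_const_nhds.congr fun n => ?_)
    simp [pow_mul]
  have v2 : L = 1 / (1 - D) - β * w := by
    refine tendsto_nhds_unique hodd (tendsto_const_nhds.congr fun n => ?_)
    simp [pow_succ, pow_mul]; ring
  have := mul_pos hβ hw0
  linarith

end Oscillating

/-! ### Zeros of zeta, (ISP)_D and the Riemann hypothesis -/

namespace FractalString

/-- If the zeta function vanishes at a point of the critical strip with real part `D`, then the
inverse spectral problem in dimension `D` has a negative answer. -/
theorem not_isp_of_riemannZeta_eq_zero {s : ℂ} (h0 : 0 < s.re) (h1 : s.re < 1)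
    (hz : riemannZeta s = 0) : ¬ ISP s.re := by
  intro hisp
  have hneg := riemannZeta_re_neg_of_mem_Ioo h0 h1
  -- A real s in (0, 1) would contradict ζ < 0 there.
  have hτ : s.im ≠ 0 := fun h => by
    have : ((s.re : ℝ) : ℂ) = s := Complex.ext (by simp) (by simp [h])
    rw [this, hz] at hneg
    simp at hneg
  obtain ⟨β, hβ, hβ2, ℓ, hpos, hsum, hcount⟩ := exists_oscillating_lengths h0 h1 (s := s) rfl
  obtain ⟨Ω, hΩ, e, he⟩ := exists_fractalString hpos hsum
  have hf := fractSum_comp_equiv e he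
  have ht := tubeSum_comp_equiv e he
  obtain ⟨hlow, hup⟩ := tubeSum_bounds h0 h1 rfl hβ.le hβ2 hpos hsum hcount
  have hdim : minkowskiDim Ω = s.re := by
    refine minkowskiDim_eq hΩ.isOpen hΩ.isBounded h0.le (c := 1 / (4 * (1 - s.re))) ?_
      (by rw [ht]; exact hlow) (by rw [ht]; exact hup)
    have : 0 < 1 - s.re := by linarith
    positivity
  have hmeas := hisp Ω hΩ hdim ⟨-(riemannZeta s.re).re, (neg_pos.2 hneg).ne', by
    rw [spectral_asymptotics_iff hΩ.isOpen hΩ.isBounded, hf]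
    exact tendsto_fractSum_of_zero h0 h1 rfl hz hβ.le (by linarith) hpos hsum hcount⟩
  obtain ⟨L, hL⟩ := tendsto_of_isMinkowskiMeasurable hΩ.isOpen hΩ.isBounded hmeas
  rw [hdim, ht] at hL
  exact not_tendsto_tubeSum h0 h1 rfl hτ hβ hpos hsum hcount L hL

theorem isp_of_riemannHypothesis (hRH : RiemannHypothesis) {D : ℝ} (h0 : 0 < D) (h1 : D < 1)
    (hD : D ≠ 1 / 2) : ISP D := by
  refine isp_of_riemannZeta_ne_zero h0 h1 fun ξ hz => hD ?_
  set s : ℂ := D + 2 * Real.pi * ξ * Complex.I with hs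
  have hre : s.re = D := by simp [hs]
  rw [← hre]
  refine hRH s hz ?_ ?_
  · rintro ⟨n, hn⟩
    have := congrArg Complex.re hn
    rw [hre] at this
    simp at this
    nlinarith [(Nat.cast_nonneg n : (0 : ℝ) ≤ n)]
  · intro h
    rw [h] at hre
    simp at hre; linarith

end FractalString

theorem riemannZeta_eq_zero_of_one_sub {s : ℂ} (h0 : 0 < s.re) (h1 : s.re < 1)
    (hz : riemannZeta s = 0) : riemannZeta (1 - s) = 0 := by
  rw [riemannZeta_one_sub, hz, mul_zero]
  · intro n h
    have := congrArg Complex.re h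
    simp at this
    linarith [(Nat.cast_nonneg n : (0 : ℝ) ≤ n)]
  · intro h
    simp [h] at h1

/-- A zero of the zeta function with nonpositive real part is a trivial zero. -/
theorem eq_neg_two_mul_of_riemannZeta_eq_zero {s : ℂ} (hs : s.re ≤ 0) (hz : riemannZeta s = 0) :
    ∃ n : ℕ, s = -2 * (n + 1) := by
  have hs0 : s ≠ 0 := by
    rintro rfl
    rw [riemannZeta_zero] at hz
    norm_num at hz
  have hw : 1 ≤ (1 - s).re := by simpa using hs
  have hw' : ∀ n : ℕ, 1 - s ≠ -n := by
    intro n h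
    rw [h] at hw
    simp at hw
    linarith [(Nat.cast_nonneg n : (0 : ℝ) ≤ n)]
  have hf := riemannZeta_one_sub hw' (fun h => hs0 (by linear_combination -h))
  rw [sub_sub_cancel, hz] at hf
  -- As Re(1 - s) ≥ 1, the power, Gamma and zeta factors of the functional equation are nonzero, so
  -- the cosine vanishes.
  have hcos : Complex.cos (Real.pi * (1 - s) / 2) = 0 := by
    have h2 : (2 * (Real.pi : ℂ)) ^ (-(1 - s)) ≠ 0 := by
      rw [Complex.cpow_ne_zero_iff]
      left
      exact mul_ne_zero two_ne_zero (by exact_mod_cast Real.pi_ne_zero)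
    have h3 := Complex.Gamma_ne_zero hw'
    have h4 := riemannZeta_ne_zero_of_one_le_re hw
    simpa [h2, h3, h4] using hf.symm
  obtain ⟨k, hk⟩ := Complex.cos_eq_zero_iff.1 hcos
  have hpi : (Real.pi : ℂ) ≠ 0 := by exact_mod_cast Real.pi_ne_zero
  have hsk : s = -2 * (k : ℂ) := by
    have : (1 - s) = 2 * k + 1 := by
      field_simp at hk
      exact hk
    linear_combination -this
  -- k = 0 would give s = 0, where ζ is nonzero.
  have hk0 : 0 < k := by
    have h5 := congrArg Complex.re hsk
    simp at h5
    have h6 : (0 : ℝ) ≤ k := by linarith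
    have h7 : 0 ≤ k := by exact_mod_cast h6
    refine lt_of_le_of_ne h7 fun h => hs0 ?_
    rw [hsk, ← h]; simp
  obtain ⟨n, hn⟩ := Int.eq_succ_of_zero_lt hk0
  refine ⟨n, ?_⟩
  rw [hsk, hn]
  push_cast; ring

theorem FractalString.riemannHypothesis_of_isp (h : ∀ D : ℝ, 0 < D → D < 1 / 2 → ISP D) :
    RiemannHypothesis := by
  intro s hz htriv _
  have h0 : 0 < s.re := by
    by_contra! hle
    exact htriv (eq_neg_two_mul_of_riemannZeta_eq_zero hle hz)
  have h1 : s.re < 1 := by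
    by_contra! hle
    exact riemannZeta_ne_zero_of_one_le_re hle hz
  rcases lt_trichotomy s.re (1 / 2) with hlt | heq | hgt
  · exact absurd (h _ h0 hlt) (not_isp_of_riemannZeta_eq_zero h0 h1 hz)
  · exact heq
  -- A zero right of the critical line reflects to one on its left, where (ISP)_D is assumed.
  · have hre : (1 - s).re = 1 - s.re := by simp
    exact absurd (h (1 - s).re (by rw [hre]; linarith) (by rw [hre]; linarith))
      (not_isp_of_riemannZeta_eq_zero (by rw [hre]; linarith) (by rw [hre]; linarith)
        (riemannZeta_eq_zero_of_one_sub h0 h1 hz))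

theorem theorem6p2 :
    ((∀ D : ℝ, 0 < D → D < 1 → D ≠ 1 / 2 → FractalString.ISP D) ↔ RiemannHypothesis) ∧
    ((∀ D : ℝ, 0 < D → D < 1 / 2 → FractalString.ISP D) ↔ RiemannHypothesis) := by
  refine ⟨⟨fun h => ?_, fun h D h0 h1 hD => ?_⟩, fun h => ?_, fun h D h0 h1 => ?_⟩
  · exact FractalString.riemannHypothesis_of_isp fun D h0 h1 => h D h0 (by linarith) h1.ne
  · exact FractalString.isp_of_riemannHypothesis h h0 h1 hD
  · exact FractalString.riemannHypothesis_of_isp h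
  · exact FractalString.isp_of_riemannHypothesis h h0 (by linarith) h1.ne
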